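/- **Setting.** Let $\mathbb F$ be a finite field and $\lambda,\kappa,\mu,S,\ell,K_c$ positive integers; put $L=\ell K_c$ and $R=(\ell+1)K_c-1$, and assume $R\le S$ and $L\le|\mathbb F|-S$. There are input matrices $\mathbf A_1,\dots,\mathbf A_L\in\mathbb F^{\lambda\times\kappa}$ and $\mathbf B_1,\dots,\mathbf B_L\in\mathbb F^{\kappa\times\mu}$. A code $(f,g,h,d)$ for distributed batch matrix multiplication with $S$ servers sends to server $s$ the vectors $\widetilde A^s=f_s(\mathbf A)$ and $\widetilde B^s=g_s(\mathbf B)$ over $\mathbb F$; server $s$ answers with the vector $Y_s=h_s(\widetilde A^s,\widetilde B^s)$ over $\mathbb F$, and for a set $T$ of responsive servers the user computes $d_T((Y_s)_{s\in T})$. The code is $r$-recoverable if $d_T((Y_s)_{s\in T})=(\mathbf A_1\mathbf B_1,\dots,\mathbf A_L\mathbf B_L)$ for all $T$ with $|T|=r$ and all $\mathbf A,\mathbf B$; its recovery threshold is the least such $r$. Writing $|v|$ for the number of coordinates of $v$ and $R$ for the recovery threshold, the costs are $U_A=\frac{\sum_s|\widetilde A^s|}{L\lambda\kappa}$, $U_B=\frac{\sum_s|\widetilde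 B^s|}{L\kappa\mu}$, $D=\max_{|T|=R}\frac{\sum_{s\in T}|Y_s|}{L\lambda\mu}$. The complexities $\mathcal C_s$, $\mathcal C_{eA}$, $\mathcal C_{eB}$, $\mathcal C_d$ are the numbers of arithmetic operations in $\mathbb F$ (of straight-line programs, in which constants of $\mathbb F$ are free) needed to compute, respectively, $h_s$, all of $f=(f_1,\dots,f_S)$, all of $g=(g_1,\dots,g_S)$, and $d_T$ (maximized over $|T|=R$), each divided by $L$. **CSA codes.** Let $(f_{l,k})_{l\in[\ell],k\in[K_c]}$ and $(\alpha_s)_{s\in[S]}$ be $L+S$ distinct elements of $\mathbb F$, and put $\mathbf A_{l,k}=\mathbf A_{K_c(l-1)+k}$, $\mathbf B_{l,k}=\mathbf B_{K_c(l-1)+k}$. Server $s$ receives, for all $l\in[\ell]$, $$\widetilde A^s_l=\Big(\prod_{k}(f_{l,k}-\alpha_s)\Big)\sum_{k}\frac{\mathbf A_{l,k}}{f_{l,k}-\alpha_s},\qquad \widetilde B^s_l=\sum_{k}\frac{\mathbf B_{l,k}}{f_{l,k}-\alpha_s},$$ and answers with $Y_s=\sum_{l}\widetilde A^s_l\widetilde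 B^s_l$. The user multiplies the received answers by the inverse of the Cauchy–Vandermonde matrix with rows $\big(\frac1{f_{1,1}-\alpha_s},\dots,\frac1{f_{\ell,K_c}-\alpha_s},1,\alpha_s,\dots,\alpha_s^{K_c-2}\big)$, $s\in T$, and divides the $(l,k)$-th component by $\prod_{k'\ne k}(f_{l,k'}-f_{l,k})$, for all $(l,k)$. **Theorem 1.** Such distinct elements exist, and for every choice of them the CSA code has recovery threshold $R=(\ell+1)K_c-1$: the products are recovered from the answers of any $R$ servers (and no decoding function recovers them from the answers of fewer than $R$ servers). Moreover $$(U_A,U_B)=\Big(\frac S{K_c},\frac S{K_c}\Big),\qquad D=\frac{(\ell+1)K_c-1}{\ell K_c},$$ $$\mathcal C_s=\mathcal O\Big(\frac{\lambda\kappa\mu}{K_c}\Big),\quad \mathcal C_{eA}=\widetilde{\mathcal O}\Big(\frac{\lambda\kappa S\log^2S}{K_c}\Big),\quad \mathcal C_{eB}=\widetilde{\mathcal O}\Big(\frac{\kappa\mu S\log^2S}{K_c}\Big),\quad \mathcal C_d=\widetilde{\mathcal O}\big(\lambda\mu\log^2R\big).$$ Here the constants in the $\mathcal O$'s are absolute (they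 depend neither on $\mathbb F$ nor on the parameters or evaluation points), and $\widetilde{\mathcal O}(a\log^2b)$ means $\mathcal O(a\log^2b)$ if $\mathbb F$ supports the fast Fourier transform of size $b$ (it contains a primitive $2^k$-th root of unity with $2^k\ge b$), and $\mathcal O(a\log^2b\,\log\log b)$ otherwise; in these bounds $\log x$ is read as $\log_2(x+1)$, so that they make sense for small $b$. -/

import Mathlib

universe u

/-! ### Arithmetic complexity: straight-line programs over a field -/

namespace CSA

/-- The scalar functions on `X` at the disposal of a straight-line program after `t` steps: the
inputs `inp i`, the constants of `F`, and the results `G 0, …, G (t - 1)` of the earlier steps. -/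
def Available {F X ι : Type*} (inp : ι → X → F) (G : ℕ → X → F) (t : ℕ) : Set (X → F) :=
  Set.range inp ∪ Set.range (fun (c : F) (_ : X) => c) ∪ G '' {s | s < t}

/-- `G 0, …, G (n - 1)` is a straight-line program with `n` arithmetic operations: each step is
a sum, a difference, a product or a quotient of two available quantities, where a divisor must
never vanish. -/
def IsStraightLine {F X ι : Type*} [Field F] (inp : ι → X → F) (G : ℕ → X → F) (n : ℕ) : Prop :=
  ∀ t < n, ∃ u ∈ Available inp G t, ∃ w ∈ Available inp G t,
    G t = u + w ∨ G t = u - w ∨ G t = u * w ∨ ((∀ x, w x ≠ 0) ∧ G t = u / w)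

/-- All the output functions `out o` can be computed together from the inputs `inp i` with `n`
arithmetic operations in `F`. -/
def ComputableWithOps {F X ι o : Type*} [Field F] (inp : ι → X → F) (out : o → X → F) (n : ℕ) : Prop :=
  ∃ G : ℕ → X → F, IsStraightLine inp G n ∧ ∀ p, out p ∈ Available inp G n

/-- `F` supports the (radix-two) fast Fourier transform at size `b`: it has a primitive root of
unity of order `2 ^ k` for some `2 ^ k ≥ b`. -/
def SupportsFFT (F : Type*) [Field F] (b : ℕ) : Prop :=
  ∃ (k : ℕ) (ω : F), b ≤ 2 ^ k ∧ IsPrimitiveRoot ω (2 ^ k)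

/-- The base-two logarithm of `x + 1`: of the order of `log x`, and at least `1` when `x ≥ 1`. -/
noncomputable def lg (x : ℝ) : ℝ := Real.logb 2 (x + 1)

open Classical in
/-- The factor that `Õ(log² b)` stands for: `log² b` if the field supports the fast Fourier
transform, and `log² b · log log b` if it does not. -/
noncomputable def softLogSq (F : Type*) [Field F] (b : ℕ) : ℝ :=
  if SupportsFFT F b then lg b ^ 2 else lg b ^ 2 * lg (lg b)

/-! ### Coded distributed batch matrix multiplication -/

/-- A code `(f, g, h, d)` for the distributed computation of `L` products of a `lam × kap` matrix
with a `kap × mu` matrix over `F` by `S` servers. The encoded inputs and the answer of server `s`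
are vectors over `F` with coordinates indexed by `ShA s`, `ShB s` and `Ans s`. -/
structure CDBMMCode (F : Type*) (S L lam kap mu : ℕ) where
  ShA : Fin S → Type
  ShB : Fin S → Type
  Ans : Fin S → Type
  [fintypeA : ∀ s, Fintype (ShA s)]
  [fintypeB : ∀ s, Fintype (ShB s)]
  [fintypeAns : ∀ s, Fintype (Ans s)]
  encA : ∀ s, (Fin L → Matrix (Fin lam) (Fin kap) F) → (ShA s → F)
  encB : ∀ s, (Fin L → Matrix (Fin kap) (Fin mu) F) → (ShB s → F)
  ans : ∀ s, (ShA s → F) → (ShB s → F) → (Ans s → F)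
  dec : ∀ T : Finset (Fin S), (∀ s : T, Ans s → F) → (Fin L → Matrix (Fin lam) (Fin mu) F)

attribute [instance] CDBMMCode.fintypeA CDBMMCode.fintypeB CDBMMCode.fintypeAns

namespace CDBMMCode

variable {F : Type*} {S L lam kap mu : ℕ}

/-- The answers of the servers in `T` when the inputs are `A` and `B`. -/
def answers (c : CDBMMCode F S L lam kap mu) (T : Finset (Fin S))
    (A : Fin L → Matrix (Fin lam) (Fin kap) F) (B : Fin L → Matrix (Fin kap) (Fin mu) F) :
    ∀ s : T, c.Ans s → F :=
  fun s => c.ans s (c.encA s A) (c.encB s B)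

/-- The answers of any `r` servers are decoded to the desired products. -/
def IsRecoverable [Field F] (c : CDBMMCode F S L lam kap mu) (r : ℕ) : Prop :=
  ∀ T : Finset (Fin S), T.card = r → ∀ A B, c.dec T (c.answers T A B) = fun l => A l * B l

/-- The least `r` such that the code is `r`-recoverable. -/
noncomputable def recoveryThreshold [Field F] (c : CDBMMCode F S L lam kap mu) : ℕ :=
  sInf {r | c.IsRecoverable r}

/-- The normalized upload cost for `A`. -/
noncomputable def uploadCostA (c : CDBMMCode F S L lam kap mu) : ℝ :=
  (∑ s, (Fintype.card (c.ShA s) : ℝ)) / (L * lam * kap)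

/-- The normalized upload cost for `B`. -/
noncomputable def uploadCostB (c : CDBMMCode F S L lam kap mu) : ℝ :=
  (∑ s, (Fintype.card (c.ShB s) : ℝ)) / (L * kap * mu)

/-- The normalized download cost: the largest number of symbols downloaded from a set of servers
whose size is the recovery threshold, over the number of symbols in the desired products. -/
noncomputable def downloadCost [Field F] (c : CDBMMCode F S L lam kap mu) : ℝ :=
  (((Finset.univ.powersetCard c.recoveryThreshold).sup
      fun T : Finset (Fin S) => ∑ s ∈ T, Fintype.card (c.Ans s) : ℕ) : ℝ) / (L * lam * mu)

/-- The computational complexity at each server, normalized by `L`, is at most `b`. -/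
def ServerComplexityLE [Field F] (c : CDBMMCode F S L lam kap mu) (b : ℝ) : Prop :=
  ∀ s, ∃ n : ℕ, (n : ℝ) / L ≤ b ∧
    ComputableWithOps (X := (c.ShA s → F) × (c.ShB s → F))
      (Sum.elim (fun i x => x.1 i) (fun j x => x.2 j))
      (fun p x => c.ans s x.1 x.2 p) n

/-- The complexity of encoding `A` for all the servers, normalized by `L`, is at most `b`. -/
def EncodingComplexityALE [Field F] (c : CDBMMCode F S L lam kap mu) (b : ℝ) : Prop :=
  ∃ n : ℕ, (n : ℝ) / L ≤ b ∧
    ComputableWithOps (X := Fin L → Matrix (Fin lam) (Fin kap) F)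
      (fun (q : Fin L × Fin lam × Fin kap) A => A q.1 q.2.1 q.2.2)
      (fun (p : Σ s, c.ShA s) A => c.encA p.1 A p.2) n

/-- The complexity of encoding `B` for all the servers, normalized by `L`, is at most `b`. -/
def EncodingComplexityBLE [Field F] (c : CDBMMCode F S L lam kap mu) (b : ℝ) : Prop :=
  ∃ n : ℕ, (n : ℝ) / L ≤ b ∧
    ComputableWithOps (X := Fin L → Matrix (Fin kap) (Fin mu) F)
      (fun (q : Fin L × Fin kap × Fin mu) B => B q.1 q.2.1 q.2.2)
      (fun (p : Σ s, c.ShB s) B => c.encB p.1 B p.2) n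

/-- The decoding complexity, maximized over the sets of responsive servers whose size is the
recovery threshold and normalized by `L`, is at most `b`. -/
def DecodingComplexityLE [Field F] (c : CDBMMCode F S L lam kap mu) (b : ℝ) : Prop :=
  ∀ T : Finset (Fin S), T.card = c.recoveryThreshold → ∃ n : ℕ, (n : ℝ) / L ≤ b ∧
    ComputableWithOps (X := ∀ s : T, c.Ans s → F)
      (fun (q : Σ s : T, c.Ans s) y => y q.1 q.2)
      (fun (p : Fin L × Fin lam × Fin mu) y => c.dec T y p.1 p.2.1 p.2.2) n

end CDBMMCode

/-! ### Cross-subspace-alignment codes -/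

variable {F : Type*} [Field F] {S ℓ Kc : ℕ}

/-- `Δ_s^l = ∏_k (f_{l,k} - α_s)`. -/
def Delta (f : Fin ℓ → Fin Kc → F) (α : Fin S → F) (l : Fin ℓ) (s : Fin S) : F :=
  ∏ k, (f l k - α s)

/-- `Ã_l^s = Δ_s^l ∑_k (f_{l,k} - α_s)⁻¹ A_{l,k}`. Here and below, `A_{l,k}` is the `k`-th matrix
of the `l`-th group of `Kc` consecutive matrices: `finProdFinEquiv (l, k) = k + Kc * l`. -/
def shareA {lam kap : ℕ} (f : Fin ℓ → Fin Kc → F) (α : Fin S → F) (s : Fin S)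
    (A : Fin (ℓ * Kc) → Matrix (Fin lam) (Fin kap) F) (l : Fin ℓ) : Matrix (Fin lam) (Fin kap) F :=
  Delta f α l s • ∑ k, (1 / (f l k - α s)) • A (finProdFinEquiv (l, k))

/-- `B̃_l^s = ∑_k (f_{l,k} - α_s)⁻¹ B_{l,k}`. -/
def shareB {kap mu : ℕ} (f : Fin ℓ → Fin Kc → F) (α : Fin S → F) (s : Fin S)
    (B : Fin (ℓ * Kc) → Matrix (Fin kap) (Fin mu) F) (l : Fin ℓ) : Matrix (Fin kap) (Fin mu) F :=
  ∑ k, (1 / (f l k - α s)) • B (finProdFinEquiv (l, k))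

/-- The Cauchy–Vandermonde matrix, with the row `1/(f_{1,1} - α_s), …, 1/(f_{ℓ,Kc} - α_s), 1, α_s,
…, α_s ^ (Kc - 2)` for each responsive server `s ∈ T`. -/
def cauchyVandermonde (f : Fin ℓ → Fin Kc → F) (α : Fin S → F) (T : Finset (Fin S)) :
    Matrix T ((Fin ℓ × Fin Kc) ⊕ Fin (Kc - 1)) F :=
  Matrix.of fun s => Sum.elim (fun p => 1 / (f p.1 p.2 - α s)) (fun i => α s ^ (i : ℕ))

open Classical in
/-- A left inverse of the Cauchy–Vandermonde matrix (its inverse, when that matrix is square and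
invertible), or `0` if there is none. -/
noncomputable def decodingMatrix (f : Fin ℓ → Fin Kc → F) (α : Fin S → F) (T : Finset (Fin S)) :
    Matrix ((Fin ℓ × Fin Kc) ⊕ Fin (Kc - 1)) T F :=
  if h : ∃ W : Matrix ((Fin ℓ × Fin Kc) ⊕ Fin (Kc - 1)) T F, W * cauchyVandermonde f α T = 1
  then h.choose else 0

/-- `c_{l,k} = ∏_{k' ≠ k} (f_{l,k'} - f_{l,k})`. -/
def residueCoeff (f : Fin ℓ → Fin Kc → F) (l : Fin ℓ) (k : Fin Kc) : F :=
  ∏ k' ∈ Finset.univ.erase k, (f l k' - f l k)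

/-- The CSA code with parameters `(ℓ, Kc)` and evaluation points `f_{l,k}`, `α_s`: server `s` gets
the shares `Ã_l^s`, `B̃_l^s` for all `l`, answers `∑_l Ã_l^s B̃_l^s`, and the user inverts the
Cauchy–Vandermonde system and divides by the constants `c_{l,k}`. -/
noncomputable def csaCode (f : Fin ℓ → Fin Kc → F) (α : Fin S → F) (lam kap mu : ℕ) :
    CDBMMCode F S (ℓ * Kc) lam kap mu where
  ShA := fun _ => Fin ℓ × Fin lam × Fin kap
  ShB := fun _ => Fin ℓ × Fin kap × Fin mu
  Ans := fun _ => Fin lam × Fin mu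
  encA := fun s A p => shareA f α s A p.1 p.2.1 p.2.2
  encB := fun s B p => shareB f α s B p.1 p.2.1 p.2.2
  ans := fun _ a b p => ∑ l, ∑ j, a (l, p.1, j) * b (l, j, p.2)
  dec := fun T y q => Matrix.of fun i j =>
    (residueCoeff f (finProdFinEquiv.symm q).1 (finProdFinEquiv.symm q).2)⁻¹ *
      ∑ s : T, decodingMatrix f α T (Sum.inl (finProdFinEquiv.symm q)) s * y s (i, j)

end CSA

namespace CSA

/-! ### Calculus of straight-line programs -/

section Reach

variable {F X ι ι' o : Type*}

/-! The proof has an algebraic half (recovery) and an algorithmic half (complexity); they meet in an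
explicit formula for the decoder.

Recovery. Inside one group, the factor `Delta` times a product of two Cauchy terms is a polynomial
in `α_s` of degree at most `Kc - 2` when the two indices differ; when they agree there is in
addition a simple pole with coefficient `residueCoeff` (`exists_aligned`). So the answers are the
Cauchy–Vandermonde matrix applied to the scaled products and to `Kc - 1` interference terms
(`exists_answers_eq`). That matrix is square for `R` servers, and Lagrange interpolation at the
`α_s` gives the rows of its inverse that matter: they are a Cauchy matrix scaled on both sides by
nonzero constants (`decodingRow`, `decodingMatrix_inl`). When fewer servers answer, the column of
the inverse that belongs to a missing server yields two pairs of inputs with equal answers and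
different products (`exists_indistinguishable`), which defeats every decoder.

Complexity. Each entry of the shares and of the decoded products is computed by a Cauchy matrix
between two diagonal ones. All matrices depend on the evaluation points only, so everything derived
from these is a free constant and only operations that are linear in the data are charged. It
remains to apply a Cauchy matrix of size `b` fast (`reach_cauchy`): weighted power sums come from
adding fractions `w i / (1 - x i Z)` along a product tree and expanding the result as a power series
(`reach_powerSums`); a second product tree, descended from the root, turns power sums into the
values `∑ w i / (x i - y j)` (`reach_descend`). Each of the `log b` levels consists of products with
constant Toeplitz matrices.

Toeplitz products cost `O(log b)` per coordinate by the FFT if `F` has the root of unity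
(`fastToeplitz_of_isPrimitiveRoot`). Otherwise they are read off a product in a cyclotomic algebra,
computed by the Schönhage–Strassen recursion with radix 2, or 3 in characteristic 2
(`CycBasis.reach_mul`), at the price of another factor `log log b`. -/

theorem available_mono (inp : ι → X → F) {G H : ℕ → X → F} {s t : ℕ} (hst : s ≤ t)
    (h : ∀ i < s, G i = H i) : Available inp G s ⊆ Available inp H t := by
  rintro u (hu | ⟨i, hi, rfl⟩)
  · exact Or.inl hu
  · exact Or.inr ⟨i, lt_of_lt_of_le hi hst, (h i hi).symm⟩

theorem available_congr {inp : ι → X → F} {inp' : ι' → X → F}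
    (h : Set.range inp = Set.range inp') (G : ℕ → X → F) (t : ℕ) :
    Available inp G t = Available inp' G t := by
  simp only [Available, h]

variable [Field F]

/-- All the functions in `Q` can be computed together from those in `P` with `n` operations. -/
def Reach (P Q : Set (X → F)) (n : ℕ) : Prop :=
  ComputableWithOps (fun p : P => (p : X → F)) (fun q : Q => (q : X → F)) n

theorem Reach.computableWithOps {inp : ι → X → F} {out : o → X → F} {n : ℕ}
    (h : Reach (Set.range inp) (Set.range out) n) : ComputableWithOps inp out n := by
  obtain ⟨G, hG, hout⟩ := h
  have e : ∀ t, Available (fun p : Set.range inp => (p : X → F)) G t = Available inp G t :=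
    fun t => available_congr Subtype.range_coe G t
  refine ⟨G, fun t ht => ?_, fun p => ?_⟩
  · have := hG t ht
    rwa [e] at this
  · have := hout ⟨out p, p, rfl⟩
    rwa [e] at this

variable {P P' Q Q' R : Set (X → F)} {a b n m : ℕ}

theorem Reach.of_subset (h : Q ⊆ P) : Reach P Q 0 :=
  ⟨fun _ _ => 0, fun t ht => absurd ht (Nat.not_lt_zero t),
    fun q => Or.inl (Or.inl ⟨⟨q, h q.2⟩, rfl⟩)⟩

/-- Programs are concatenated: the second one is shifted by `a` steps, and its inputs are already
available by then. -/
theorem Reach.trans (h₁ : Reach P Q a) (h₂ : Reach Q R b) : Reach P R (a + b) := by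
  obtain ⟨G, hG, hQ⟩ := h₁
  obtain ⟨H, hH, hR⟩ := h₂
  set K : ℕ → X → F := fun t => if t < a then G t else H (t - a) with hK
  have key : ∀ s, Available (fun q : Q => (q : X → F)) H s ⊆
      Available (fun p : P => (p : X → F)) K (a + s) := by
    rintro s u ((⟨q, rfl⟩ | hc) | ⟨i, hi, rfl⟩)
    · exact available_mono _ (Nat.le_add_right a s) (fun i hi => by simp [hK, hi]) (hQ q)
    · exact Or.inl (Or.inr hc)
    · refine Or.inr ⟨a + i, ?_, ?_⟩
      · simpa using hi
      · simp [hK]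
  refine ⟨K, fun t ht => ?_, fun r => key b (hR r)⟩
  by_cases hta : t < a
  · obtain ⟨u, hu, w, hw, h⟩ := hG t hta
    have hsub := available_mono (fun p : P => (p : X → F)) (G := G) (H := K) le_rfl
      (fun i (hi : i < t) => by simp [hK, hi.trans hta])
    refine ⟨u, hsub hu, w, hsub hw, ?_⟩
    simpa [hK, hta] using h
  · obtain ⟨s, rfl⟩ := Nat.exists_eq_add_of_le (not_lt.1 hta)
    obtain ⟨u, hu, w, hw, h⟩ := hH s (by omega)
    refine ⟨u, key s hu, w, key s hw, ?_⟩
    simpa [hK] using h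

theorem Reach.mono_left (h : Reach P Q n) (hP : P ⊆ P') : Reach P' Q n := by
  simpa using (Reach.of_subset hP).trans h

theorem Reach.mono_right (h : Reach P Q n) (hQ : Q' ⊆ Q) : Reach P Q' n := by
  simpa using h.trans (Reach.of_subset hQ)

theorem Reach.singleton_of_op {u w v : X → F} (hu : u ∈ P) (hw : w ∈ P)
    (h : v = u + w ∨ v = u - w ∨ v = u * w) : Reach P {v} 1 := by
  refine ⟨fun _ => v, fun t _ => ⟨u, Or.inl (Or.inl ⟨⟨u, hu⟩, rfl⟩), w,
    Or.inl (Or.inl ⟨⟨w, hw⟩, rfl⟩), ?_⟩, ?_⟩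
  · tauto
  · rintro ⟨q, rfl⟩
    exact Or.inr ⟨0, by simp, rfl⟩

theorem Reach.add {u w : X → F} (hu : u ∈ P) (hw : w ∈ P) : Reach P {u + w} 1 :=
  Reach.singleton_of_op hu hw (Or.inl rfl)

theorem Reach.mul {u w : X → F} (hu : u ∈ P) (hw : w ∈ P) : Reach P {u * w} 1 :=
  Reach.singleton_of_op hu hw (Or.inr (Or.inr rfl))

theorem Reach.frame (h : Reach P Q n) : Reach P (P ∪ Q) n := by
  obtain ⟨G, hG, hQ⟩ := h
  refine ⟨G, hG, ?_⟩
  rintro ⟨q, hq | hq⟩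
  · exact Or.inl (Or.inl ⟨⟨q, hq⟩, rfl⟩)
  · exact hQ ⟨q, hq⟩

theorem Reach.union (h₁ : Reach P Q a) (h₂ : Reach P R b) : Reach P (Q ∪ R) (a + b) :=
  (h₁.frame.trans ((h₂.mono_left Set.subset_union_left).frame)).mono_right (by
    intro u hu
    rcases hu with hu | hu
    · exact Or.inl (Or.inr hu)
    · exact Or.inr hu)

/-- All the constant functions. -/
theorem Reach.consts : Reach P (Set.range fun (c : F) (_ : X) => c) 0 :=
  ⟨fun _ _ => 0, fun t ht => absurd ht (Nat.not_lt_zero t), fun q => Or.inl (Or.inr q.2)⟩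

theorem Reach.trans_consts (h₁ : Reach P Q a)
    (h₂ : Reach (Q ∪ Set.range fun (c : F) (_ : X) => c) R b) : Reach P R (a + b) := by
  simpa using (h₁.union Reach.consts).trans h₂

/-- Constants are free. This is what makes all precomputation from the evaluation points cost
nothing. -/
theorem Reach.drop_consts (h : Reach (P ∪ Set.range fun (c : F) (_ : X) => c) R b) :
    Reach P R b := by
  simpa using (Reach.of_subset (subset_refl P)).trans_consts h

theorem Reach.mono_ops (h : Reach P Q n) (hnm : n ≤ m) : Reach P Q m := by
  obtain ⟨k, rfl⟩ := Nat.exists_eq_add_of_le hnm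
  clear hnm
  induction k with
  | zero => exact h
  | succ k ih =>
    -- A dummy operation `0 + 0` pads the program.
    have h0 : Reach P {(fun _ => 0 : X → F) + fun _ => 0} 1 :=
      Reach.drop_consts (Reach.add (Or.inr ⟨0, rfl⟩) (Or.inr ⟨0, rfl⟩))
    exact (ih.union h0).mono_right Set.subset_union_left

theorem Reach.biUnion {J : Type*} (s : Finset J) {Q : J → Set (X → F)} {n : J → ℕ}
    (h : ∀ j ∈ s, Reach P (Q j) (n j)) : Reach P (⋃ j ∈ s, Q j) (∑ j ∈ s, n j) := by
  classical
  induction s using Finset.induction_on with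
  | empty => simpa using Reach.of_subset (Set.empty_subset P)
  | insert j s hj ih =>
    rw [Finset.sum_insert hj, Finset.set_biUnion_insert]
    exact (h j (Finset.mem_insert_self j s)).union
      (ih fun i hi => h i (Finset.mem_insert_of_mem hi))

theorem Reach.of_forall {J : Type*} (s : Finset J) {Q : J → Set (X → F)}
    (h : ∀ j ∈ s, Reach P (Q j) n) (hR : R ⊆ ⋃ j ∈ s, Q j) (hm : s.card * n ≤ m) :
    Reach P R m := by
  refine ((Reach.biUnion s h).mono_right hR).mono_ops ?_
  simpa using hm

theorem Reach.const_mul {u : X → F} (hu : u ∈ P) (c : F) : Reach P {fun x => c * u x} 1 :=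
  Reach.drop_consts (Reach.mul (u := fun _ => c) (w := u) (Or.inr ⟨c, rfl⟩) (Or.inl hu))

theorem Reach.zero : Reach P {fun _ => 0} 0 :=
  Reach.consts.mono_right (by rintro _ rfl; exact ⟨0, rfl⟩)

theorem Reach.sum {J : Type*} (s : Finset J) {q : J → X → F} {n : J → ℕ}
    (h : ∀ j ∈ s, Reach P {q j} (n j)) :
    Reach P {fun x => ∑ j ∈ s, q j x} (∑ j ∈ s, (n j + 1)) := by
  classical
  induction s using Finset.induction_on with
  | empty => simpa using Reach.zero
  | insert j s hj ih =>
    have h1 := (h j (Finset.mem_insert_self j s)).union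
      (ih fun i hi => h i (Finset.mem_insert_of_mem hi))
    have h2 := h1.trans (Reach.add (Or.inl rfl) (Or.inr rfl))
    rw [Finset.sum_insert hj]
    refine (h2.mono_right ?_).mono_ops (by omega)
    rintro _ rfl
    simp only [Finset.sum_insert hj]
    rfl

theorem Reach.linearComb {J : Type*} (s : Finset J) {q : J → X → F} (c : J → F)
    (h : ∀ j ∈ s, q j ∈ P) : Reach P {fun x => ∑ j ∈ s, c j * q j x} (2 * s.card) := by
  have := Reach.sum s (fun j hj => Reach.const_mul (h j hj) (c j))
  simpa [mul_comm] using this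

/-- A linear map given by a sparse matrix costs at most two operations for each non-zero entry. -/
theorem Reach.sparse {J O : Type*} [Fintype J] [Fintype O] (M : O → J → F)
    {q : J → X → F} (hq : ∀ j, q j ∈ P) {k : ℕ}
    (hM : ∀ j, ∀ s : Finset O, (∀ o ∈ s, M o j ≠ 0) → s.card ≤ k) :
    Reach P (Set.range fun o x => ∑ j, M o j * q j x) (2 * k * Fintype.card J) := by
  classical
  have h : ∀ o : O, Reach P {fun x => ∑ j, M o j * q j x}
      (2 * (Finset.univ.filter fun j => M o j ≠ 0).card) := fun o => by
    convert Reach.linearComb (P := P) (Finset.univ.filter fun j => M o j ≠ 0) (M o)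
      (fun j _ => hq j) using 3 with x
    rw [Finset.sum_filter]
    refine Finset.sum_congr rfl fun j _ => ?_
    by_cases hj : M o j = 0 <;> simp [hj]
  refine ((Reach.biUnion Finset.univ fun o _ => h o).mono_right ?_).mono_ops ?_
  · rintro _ ⟨o, rfl⟩
    simp
  -- The cost is twice the number of nonzero entries; it is counted by rows but bounded by columns,
  -- where the hypothesis `hM` applies.
  · rw [← Finset.mul_sum, mul_assoc]
    refine Nat.mul_le_mul_left 2 ?_
    simp only [Finset.card_filter]
    rw [Finset.sum_comm]
    calc ∑ j, ∑ o, (if M o j ≠ 0 then 1 else 0) ≤ ∑ _j : J, k := by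
          refine Finset.sum_le_sum fun j _ => ?_
          rw [← Finset.card_filter]
          exact hM j _ (by simp)
      _ = k * Fintype.card J := by simp [mul_comm]

end Reach

/-! ### Programs for vector-valued quantities -/

section Coords

variable {F X D D' δ δ' J : Type*} [Field F] [AddCommGroup D] [Module F D]
  [AddCommGroup D'] [Module F D']

/-- The coordinates of a quantity with values in a space with a basis. -/
def coords (B : Module.Basis δ F D) (q : X → D) : Set (X → F) :=
  Set.range fun l x => B.repr (q x) l

variable {B : Module.Basis δ F D} {B' : Module.Basis δ' F D'} {P : Set (X → F)}

theorem mem_coords (q : X → D) (l : δ) : (fun x => B.repr (q x) l) ∈ coords B q := ⟨l, rfl⟩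

theorem Reach.coords_zero : Reach P (coords B fun _ => 0) 0 :=
  Reach.consts.mono_right (by rintro _ ⟨l, rfl⟩; exact ⟨0, by simp⟩)

variable [Fintype δ]

theorem Reach.coords_add {p q : X → D} (hp : coords B p ⊆ P) (hq : coords B q ⊆ P) :
    Reach P (coords B fun x => p x + q x) (Fintype.card δ) := by
  refine Reach.of_forall (n := 1) Finset.univ (fun l _ => Reach.add (hp (mem_coords p l))
    (hq (mem_coords q l))) ?_ (by simp)
  rintro _ ⟨l, rfl⟩
  simp only [Set.mem_iUnion]
  exact ⟨l, Finset.mem_univ l, by ext x; simp⟩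

theorem Reach.coords_sum (s : Finset J) {q : J → X → D} {n : J → ℕ}
    (h : ∀ j ∈ s, Reach P (coords B (q j)) (n j)) :
    Reach P (coords B fun x => ∑ j ∈ s, q j x) (∑ j ∈ s, (n j + Fintype.card δ)) := by
  classical
  induction s using Finset.induction_on with
  | empty => simpa using Reach.coords_zero
  | insert j s hj ih =>
    have h1 := (h j (Finset.mem_insert_self j s)).union
      (ih fun i hi => h i (Finset.mem_insert_of_mem hi))
    have h2 := h1.trans (Reach.coords_add Set.subset_union_left Set.subset_union_right)
    simp only [Finset.sum_insert hj]
    exact h2.mono_ops (by omega)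

theorem Reach.coords_sparse [Fintype δ'] (φ : D →ₗ[F] D') {k : ℕ}
    (hφ : ∀ l, ∀ s : Finset δ', (∀ o ∈ s, B'.repr (φ (B l)) o ≠ 0) → s.card ≤ k)
    {q : X → D} (hq : coords B q ⊆ P) :
    Reach P (coords B' fun x => φ (q x)) (2 * k * Fintype.card δ) := by
  refine (Reach.sparse (fun o l => B'.repr (φ (B l)) o) (fun l => hq (mem_coords q l))
    hφ).mono_right ?_
  rintro _ ⟨o, rfl⟩
  refine ⟨o, ?_⟩
  ext x
  change ∑ l, B'.repr (φ (B l)) o * B.repr (q x) l = B'.repr (φ (q x)) o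
  conv_rhs => rw [← B.sum_repr (q x)]
  simp only [map_sum, map_smul, Finsupp.coe_finsetSum, Finset.sum_apply, Finsupp.smul_apply,
    smul_eq_mul, mul_comm]

end Coords

/-! ### The fast Fourier transform over an algebra -/

section DFT

variable {F X D δ : Type*} [Field F] [CommRing D] [Algebra F D] [Fintype δ]
  {B : Module.Basis δ F D}

theorem sum_range_mul_eq {M : Type*} [AddCommMonoid M] (r n : ℕ) (g : ℕ → M) :
    ∑ i ∈ Finset.range (r * n), g i =
      ∑ i₀ ∈ Finset.range r, ∑ i ∈ Finset.range n, g (r * i + i₀) := by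
  induction n with
  | zero => simp
  | succ n ih =>
    simp only [Finset.sum_range_succ, Finset.sum_add_distrib, ← ih, Nat.mul_succ,
      Finset.sum_range_add]

/-- The radix-`r` fast Fourier transform. -/
theorem Reach.dft (r c : ℕ) (k : ℕ) : ∀ (ω : D), ω ^ r ^ k = 1 →
    (∀ (e : ℕ) (q : X → D), Reach (coords B q) (coords B fun x => ω ^ e * q x) c) →
    ∀ P : ℕ → X → D,
      Reach (⋃ i ∈ Finset.range (r ^ k), coords B (P i))
        (⋃ j ∈ Finset.range (r ^ k),
          coords B fun x => ∑ i ∈ Finset.range (r ^ k), ω ^ (i * j) * P i x)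
        (k * r ^ (k + 1) * (c + Fintype.card δ)) := by
  induction k with
  | zero =>
    intro ω _ _ P
    simpa using Reach.of_subset subset_rfl
  | succ k ih =>
    intro ω hω hc P
    set d := Fintype.card δ
    -- Decimation: the entries with index congruent to `i₀` modulo `r` are transformed with the root
    -- `ω ^ r`.
    have h1 : ∀ i₀ ∈ Finset.range r,
        Reach (⋃ i ∈ Finset.range (r ^ (k + 1)), coords B (P i))
          (⋃ j ∈ Finset.range (r ^ k), coords B fun x =>
            ∑ i ∈ Finset.range (r ^ k), (ω ^ r) ^ (i * j) * P (r * i + i₀) x)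
          (k * r ^ (k + 1) * (c + d)) := by
      intro i₀ hi₀
      refine (ih (ω ^ r) (by rw [← pow_mul, ← pow_succ', hω])
        (fun e q => by simpa only [← pow_mul] using hc (r * e) q)
        (fun i => P (r * i + i₀))).mono_left ?_
      refine Set.iUnion₂_subset fun i hi => ?_
      refine Set.subset_biUnion_of_mem (u := fun i => coords B (P i)) ?_
      simp only [Finset.coe_range, Set.mem_Iio, Finset.mem_range] at *
      rw [pow_succ']
      nlinarith
    have h2 := Reach.biUnion (Finset.range r) h1
    refine (h2.trans (Reach.of_forall (m := r ^ (k + 1) * (r * (c + d)))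
      (n := r * (c + d)) (Finset.range (r ^ (k + 1)))
      (Q := fun j => coords B fun x => ∑ i ∈ Finset.range (r ^ (k + 1)), ω ^ (i * j) * P i x)
      ?_ subset_rfl (by simp))).mono_ops (le_of_eq ?_)
    · intro j hj
      have hr : 0 < r ^ k := by
        rcases Nat.eq_zero_or_pos (r ^ k) with h | h
        · simp [pow_succ, h] at hj
        · exact h
      -- The output at `j` combines the `r` sub-transforms at `j % r ^ k` with the twiddle factors
      -- `ω ^ (i₀ * j)`. The reduction of `j` is harmless because `ω ^ r` has order dividing `r ^
      -- k`.
      have h3 := Reach.coords_sum (B := B) (n := fun _ => c) (Finset.range r)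
        (P := ⋃ i₀ ∈ Finset.range r, ⋃ j ∈ Finset.range (r ^ k), coords B fun x =>
            ∑ i ∈ Finset.range (r ^ k), (ω ^ r) ^ (i * j) * P (r * i + i₀) x)
        (q := fun i₀ x => ω ^ (i₀ * j) * ∑ i ∈ Finset.range (r ^ k),
            (ω ^ r) ^ (i * (j % r ^ k)) * P (r * i + i₀) x)
        (fun i₀ hi₀ => (hc _ _).mono_left (by
          refine subset_trans ?_ (Set.subset_biUnion_of_mem hi₀)
          exact Set.subset_biUnion_of_mem (u := fun j => coords B fun x =>
            ∑ i ∈ Finset.range (r ^ k), (ω ^ r) ^ (i * j) * P (r * i + i₀) x)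
            (by simpa using Nat.mod_lt j hr)))
      convert h3 using 1
      · congr 1
        ext x
        rw [pow_succ', sum_range_mul_eq]
        refine Finset.sum_congr rfl fun i₀ _ => ?_
        rw [Finset.mul_sum]
        refine Finset.sum_congr rfl fun i _ => ?_
        rw [← mul_assoc]
        congr 1
        have hj' : (ω ^ r) ^ j = (ω ^ r) ^ (j % r ^ k) :=
          pow_eq_pow_mod j (by rw [← pow_mul, ← pow_succ', hω])
        rw [mul_comm i (j % _), pow_mul (ω ^ r), ← hj', ← pow_mul, ← pow_mul, ← pow_add]
        congr 1
        ring
      · simp [d]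
    · simp only [Finset.sum_const, Finset.card_range, smul_eq_mul]
      ring

/-- Transform, multiply the values at `J` by constants, discard the others, transform back. -/
theorem Reach.maskedConv (r c k T : ℕ) {ω : D} (hω : ω ^ r ^ k = 1)
    (hc : ∀ (e : ℕ) (q : X → D), Reach (coords B q) (coords B fun x => ω ^ e * q x) c)
    {J : Finset ℕ} (hJ : J ⊆ Finset.range (r ^ k)) (C : ℕ → D)
    (hT : ∀ j ∈ J, ∀ q : X → D, Reach (coords B q) (coords B fun x => C j * q x) T)
    (P : ℕ → X → D) :
    Reach (⋃ i ∈ Finset.range (r ^ k), coords B (P i))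
      (⋃ i ∈ Finset.range (r ^ k), coords B fun x => ∑ j ∈ J, (ω ^ (r ^ k - 1)) ^ (j * i) *
        (C j * ∑ u ∈ Finset.range (r ^ k), ω ^ (u * j) * P u x))
      (2 * (k * r ^ (k + 1) * (c + Fintype.card δ)) + J.card * T) := by
  have h1 := Reach.dft r c k ω hω hc P
  set V : ℕ → X → D := fun j x => ∑ u ∈ Finset.range (r ^ k), ω ^ (u * j) * P u x with hV
  set M : ℕ → X → D := fun j x => if j ∈ J then C j * V j x else 0 with hM
  have h2 : Reach (⋃ j ∈ Finset.range (r ^ k), coords B (V j))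
      (⋃ j ∈ Finset.range (r ^ k), coords B (M j)) (J.card * T) := by
    have h3 : Reach (⋃ j ∈ Finset.range (r ^ k), coords B (V j))
        (⋃ j ∈ J, coords B (M j)) (J.card * T) := by
      refine Reach.of_forall J (fun j hj => ?_) subset_rfl le_rfl
      simp only [hM, hj, if_true]
      exact (hT j hj (V j)).mono_left
        (Set.subset_biUnion_of_mem (u := fun j => coords B (V j)) (hJ hj))
    refine ((h3.union Reach.consts).mono_right ?_)
    refine Set.iUnion₂_subset fun j hj => ?_
    by_cases hjJ : j ∈ J
    · exact subset_trans (Set.subset_biUnion_of_mem (u := fun j => coords B (M j)) hjJ)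
        Set.subset_union_left
    · rintro _ ⟨l, rfl⟩
      exact Or.inr ⟨0, by simp [hM, hjJ]⟩
  have h4 := Reach.dft (B := B) r c k (ω ^ (r ^ k - 1))
    (by rw [← pow_mul, mul_comm, pow_mul, hω, one_pow])
    (fun e q => by simpa only [← pow_mul] using hc ((r ^ k - 1) * e) q) M
  convert (h1.trans h2).trans h4 using 1
  · refine Set.iUnion₂_congr fun i _ => ?_
    congr 1
    ext x
    rw [← Finset.sum_subset hJ]
    · exact Finset.sum_congr rfl fun j hj => by simp [hM, hV, hj]
    · intro j _ hj
      simp [hM, hj]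
  · ring

end DFT

/-! ### Principal roots of unity -/

section PrincipalRoot

variable {F D : Type*} [Field F] [CommRing D] [Algebra F D]

/-- A principal root of unity of order `r ^ k`, where `r` is a prime number. -/
def IsPrincipalRoot (ω : D) (r k : ℕ) : Prop :=
  ω ^ r ^ k = 1 ∧ ∀ e, e + 1 = k → ∑ l ∈ Finset.range r, ω ^ (l * r ^ e) = 0

theorem IsPrincipalRoot.of_sum_eq_zero {ω : D} {r e : ℕ}
    (h : ∑ l ∈ Finset.range r, ω ^ (l * r ^ e) = 0) : IsPrincipalRoot ω r (e + 1) := by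
  refine ⟨?_, fun e' he => by obtain rfl : e' = e := by omega
                              exact h⟩
  have := mul_geom_sum (ω ^ r ^ e) r
  simp only [← pow_mul] at this
  simp only [mul_comm _ (r ^ e)] at h
  rw [h, mul_zero, eq_comm, sub_eq_zero] at this
  rw [pow_succ, this]

theorem IsPrincipalRoot.pow {ω : D} {r k : ℕ} (h : IsPrincipalRoot ω r (k + 1)) :
    IsPrincipalRoot (ω ^ r) r k := by
  refine ⟨by rw [← pow_mul, ← pow_succ', h.1], ?_⟩
  rintro e rfl
  have := h.2 (e + 1) rfl
  convert this using 2 with l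
  rw [← pow_mul]
  congr 1
  ring

theorem IsPrincipalRoot.pow_pow {ω : D} {r k : ℕ} (i : ℕ) (h : IsPrincipalRoot ω r (k + i)) :
    IsPrincipalRoot (ω ^ r ^ i) r k := by
  induction i generalizing k with
  | zero => simpa using h
  | succ i ih =>
    have h' := ih (k := k + 1) (by rwa [show k + 1 + i = k + (i + 1) by ring])
    have := h'.pow
    rwa [← pow_mul, ← pow_succ] at this

/-- Multiplication by `s` permutes the residues modulo `r`. -/
theorem sum_range_pow_mul_of_coprime {η : D} {r s : ℕ} (hη : η ^ r = 1) (hs : r.Coprime s) :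
    ∑ l ∈ Finset.range r, η ^ (s * l) = ∑ l ∈ Finset.range r, η ^ l := by
  rcases Nat.eq_zero_or_pos r with rfl | hr
  · simp
  have hinj : Set.InjOn (fun l => s * l % r) (Finset.range r) := by
    intro a ha b hb hab
    simp only [Finset.coe_range, Set.mem_Iio] at ha hb
    have h1 : a ≡ b [MOD r] := Nat.ModEq.cancel_left_of_coprime hs hab
    rwa [Nat.ModEq, Nat.mod_eq_of_lt ha, Nat.mod_eq_of_lt hb] at h1
  have himg : (Finset.range r).image (fun l => s * l % r) = Finset.range r := by
    refine Finset.eq_of_subset_of_card_le ?_ ?_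
    · intro x hx
      obtain ⟨l, _, rfl⟩ := Finset.mem_image.1 hx
      exact Finset.mem_range.2 (Nat.mod_lt _ hr)
    · rw [Finset.card_image_of_injOn hinj]
  conv_rhs => rw [← himg, Finset.sum_image hinj]
  exact Finset.sum_congr rfl fun l _ => pow_eq_pow_mod _ hη

/-- Orthogonality of characters. If `r ∣ s`, the sum reduces to one for `ω ^ r`; otherwise primality
makes `s` coprime to `r`, and each sum over a coset of the subgroup of order `r` is zero by the
defining relation. -/
theorem IsPrincipalRoot.sum_pow {r : ℕ} (hr : r.Prime) {k : ℕ} {ω : D}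
    (h : IsPrincipalRoot ω r k) (s : ℕ) :
    ∑ j ∈ Finset.range (r ^ k), ω ^ (s * j) = if r ^ k ∣ s then (r : D) ^ k else 0 := by
  induction k generalizing ω s with
  | zero => simp
  | succ k ih =>
    by_cases hs : r ∣ s
    · obtain ⟨s, rfl⟩ := hs
      have hω := h.pow
      rw [pow_succ, sum_range_mul_eq]
      have e : ∀ i₀, ∀ i, (ω ^ (r * s * (r ^ k * i + i₀))) = (ω ^ r) ^ (s * i₀) := fun i₀ i => by
        rw [show r * s * (r ^ k * i + i₀) = r * (s * i₀) + r * r ^ k * (s * i) by ring, pow_add,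
          pow_mul _ (r * r ^ k), pow_mul ω r (r ^ k), hω.1, one_pow, mul_one, pow_mul]
      simp only [e, Finset.sum_const, Finset.card_range, ← Finset.smul_sum, ih hω]
      rw [pow_succ', mul_comm (r ^ k) r]
      simp only [Nat.mul_dvd_mul_iff_left hr.pos]
      split_ifs <;> simp [nsmul_eq_mul]
    · have hs' : ¬ r ^ (k + 1) ∣ s := fun h => hs ((dvd_pow_self r (by omega)).trans h)
      rw [if_neg hs', pow_succ, sum_range_mul_eq]
      refine Finset.sum_eq_zero fun i₀ _ => ?_
      have e : ∀ i, ω ^ (s * (r ^ k * i + i₀)) = (ω ^ r ^ k) ^ (s * i) * ω ^ (s * i₀) := fun i => by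
        rw [← pow_mul, ← pow_add]
        congr 1
        ring
      simp only [e, ← Finset.sum_mul]
      rw [sum_range_pow_mul_of_coprime (by rw [← pow_mul, ← pow_succ, h.1])
        ((Nat.Prime.coprime_iff_not_dvd hr).2 hs)]
      have := h.2 k rfl
      simp only [mul_comm _ (r ^ k), pow_mul] at this
      rw [this, zero_mul]

/-- The convolution theorem when only the frequencies in `J` are kept: the cyclic delta is replaced
by the kernel `κ`, the inverse transform of the indicator of `J`. The factor `N - 1` stands for `-1`
in exponents. -/
theorem masked_conv_eq {N : ℕ} (ω : D) (J : Finset ℕ) (a : F) (κ : ℕ → F)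
    (hκ : ∀ s, a • ∑ j ∈ J, ω ^ (s * j) = algebraMap F D (κ s)) (C P : ℕ → D) (i : ℕ) :
    ∑ j ∈ J, (ω ^ (N - 1)) ^ (j * i) * ((a • ∑ u ∈ Finset.range N, ω ^ (u * j) * C u) *
      ∑ u ∈ Finset.range N, ω ^ (u * j) * P u) =
    ∑ u ∈ Finset.range N, ∑ u' ∈ Finset.range N,
      κ (u + u' + (N - 1) * i) • (C u * P u') := by
  have e : ∀ u u', κ (u + u' + (N - 1) * i) • (C u * P u') =
      ∑ j ∈ J, (a • ω ^ ((u + u' + (N - 1) * i) * j)) * (C u * P u') := fun u u' => by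
    rw [Algebra.smul_def, ← hκ, Finset.smul_sum, Finset.sum_mul]
  simp only [e]
  trans ∑ j ∈ J, ∑ u ∈ Finset.range N, ∑ u' ∈ Finset.range N,
      (a • ω ^ ((u + u' + (N - 1) * i) * j)) * (C u * P u')
  · refine Finset.sum_congr rfl fun j _ => ?_
    rw [smul_mul_assoc, Finset.sum_mul_sum, Finset.smul_sum, Finset.mul_sum]
    refine Finset.sum_congr rfl fun u _ => ?_
    rw [Finset.smul_sum, Finset.mul_sum]
    refine Finset.sum_congr rfl fun u' _ => ?_
    rw [Algebra.smul_def, Algebra.smul_def,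
      show (u + u' + (N - 1) * i) * j = (N - 1) * (j * i) + u * j + u' * j by ring, pow_add,
      pow_add, pow_mul]
    ring
  · rw [Finset.sum_comm]
    exact Finset.sum_congr rfl fun u _ => Finset.sum_comm

end PrincipalRoot

/-! ### Cyclotomic algebras with sparse multiplication by powers of the root -/

section CycBasis

/-- A basis `1, z, z ^ 2, …` of an algebra in which `1 + y + ⋯ + y ^ (r - 1) = 0` for
`y = z ^ r ^ k`. -/
structure CycBasis (F D : Type*) [Field F] [CommRing D] [Algebra F D] (r k : ℕ) where
  z : D
  basis : Module.Basis (Fin ((r - 1) * r ^ k)) F D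
  basis_apply : ∀ i, basis i = z ^ (i : ℕ)
  sum_eq : ∑ l ∈ Finset.range r, z ^ (l * r ^ k) = 0

/-- The algebra is `F[X] / (p)` for the monic `p = ∑ X ^ (l * r ^ k)`. It need not be a field. -/
theorem exists_cycBasis (F : Type u) [Field F] {r : ℕ} (hr : 2 ≤ r) (k : ℕ) :
    ∃ (D : Type u) (_ : CommRing D) (_ : Algebra F D), Nonempty (CycBasis F D r k) := by
  have hk : 0 < r ^ k := by positivity
  set p : Polynomial F := ∑ l ∈ Finset.range r, Polynomial.X ^ (l * r ^ k) with hp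
  have hp' : p = Polynomial.X ^ ((r - 1) * r ^ k) +
      ∑ l ∈ Finset.range (r - 1), Polynomial.X ^ (l * r ^ k) := by
    rw [hp, ← Nat.sub_add_cancel (by omega : 1 ≤ r), Finset.sum_range_succ, add_comm]
    simp
  have hdeg : (∑ l ∈ Finset.range (r - 1), (Polynomial.X : Polynomial F) ^ (l * r ^ k)).degree <
      ((r - 1) * r ^ k : ℕ) := by
    refine lt_of_le_of_lt (Polynomial.degree_sum_le _ _) ?_
    rw [Finset.sup_lt_iff (by exact_mod_cast WithBot.bot_lt_coe _)]
    intro l hl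
    rw [Polynomial.degree_X_pow]
    exact_mod_cast Nat.mul_lt_mul_of_pos_right (Finset.mem_range.1 hl) hk
  have hmonic : p.Monic := by
    rw [hp']
    exact Polynomial.monic_X_pow_add hdeg
  have hnat : p.natDegree = (r - 1) * r ^ k := by
    rw [hp']
    refine Polynomial.natDegree_eq_of_degree_eq_some ?_
    rw [Polynomial.degree_add_eq_left_of_degree_lt, Polynomial.degree_X_pow]
    rwa [Polynomial.degree_X_pow]
  refine ⟨AdjoinRoot p, inferInstance, inferInstance, ⟨AdjoinRoot.root p,
    (AdjoinRoot.powerBasis' hmonic).basis.reindex (finCongr hnat), fun i => ?_, ?_⟩⟩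
  · simp only [Module.Basis.reindex_apply, PowerBasis.coe_basis, AdjoinRoot.powerBasis'_gen]
    rfl
  · have := AdjoinRoot.aeval_eq (f := p) p
    rw [AdjoinRoot.mk_self] at this
    simpa [hp] using this

variable {F D X : Type*} [Field F] [CommRing D] [Algebra F D] {r k : ℕ}

theorem CycBasis.isPrincipalRoot (A : CycBasis F D r k) : IsPrincipalRoot A.z r (k + 1) :=
  .of_sum_eq_zero A.sum_eq

theorem card_le_of_repr_sum {δ J : Type*} {B : Module.Basis δ F D} (t : Finset J) (a : F)
    (i : J → δ) (s : Finset δ)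
    (hs : ∀ o ∈ s, B.repr (a • ∑ j ∈ t, B (i j)) o ≠ 0) : s.card ≤ t.card := by
  classical
  refine le_trans (Finset.card_le_card (t := t.image i) fun o ho => ?_) Finset.card_image_le
  by_contra hn
  refine hs o ho ?_
  simp only [map_smul, map_sum, Module.Basis.repr_self, Finsupp.smul_apply,
    Finsupp.coe_finsetSum, Finset.sum_apply]
  rw [Finset.sum_eq_zero, smul_zero]
  intro j hj
  rw [Finsupp.single_apply, if_neg]
  rintro rfl
  exact hn (Finset.mem_image_of_mem i hj)

/-- Exponents count modulo `r ^ (k + 1)`. After reduction, a power of `z` is either a basis element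
or, by the cyclotomic relation, minus a sum of `r - 1` basis elements. Hence multiplication by
powers of `z`, as needed in the FFT, is cheap. -/
theorem CycBasis.card_support_pow_le (A : CycBasis F D r k) (hr : 2 ≤ r) (e : ℕ)
    (s : Finset (Fin ((r - 1) * r ^ k))) (hs : ∀ o ∈ s, A.basis.repr (A.z ^ e) o ≠ 0) :
    s.card ≤ r := by
  have hk : 0 < r ^ k := by positivity
  have he : A.z ^ e = A.z ^ (e % r ^ (k + 1)) := pow_eq_pow_mod e A.isPrincipalRoot.1
  set e' := e % r ^ (k + 1) with he'
  have hlt : e' < r ^ (k + 1) := Nat.mod_lt _ (by positivity)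
  have hmul : r ^ (k + 1) = (r - 1) * r ^ k + r ^ k := by
    rw [pow_succ', ← Nat.succ_mul, Nat.succ_eq_add_one, Nat.sub_add_cancel (by omega)]
  rw [he] at hs
  by_cases h : e' < (r - 1) * r ^ k
  · have := card_le_of_repr_sum (B := A.basis) {()} 1 (fun _ => ⟨e', h⟩) s (by
      simpa [A.basis_apply] using hs)
    simp at this
    omega
  · obtain ⟨f, hf⟩ := Nat.exists_eq_add_of_le (not_lt.1 h)
    have hi : ∀ l : Fin (r - 1), (l : ℕ) * r ^ k + f < (r - 1) * r ^ k := fun l => by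
      have : ((l : ℕ) + 1) * r ^ k ≤ (r - 1) * r ^ k := Nat.mul_le_mul_right _ l.2
      rw [add_mul] at this
      omega
    have := card_le_of_repr_sum (B := A.basis) (Finset.univ : Finset (Fin (r - 1))) (-1)
      (fun l => ⟨l * r ^ k + f, hi l⟩) s (by
        convert hs using 5 with o ho
        rw [hf]
        simp only [A.basis_apply, pow_add, ← Finset.sum_mul]
        have h0 : ∑ l ∈ Finset.range (r - 1 + 1), A.z ^ (l * r ^ k) = 0 := by
          rw [Nat.sub_add_cancel (by omega)]
          exact A.sum_eq
        rw [Finset.sum_range_succ, ← eq_neg_iff_add_eq_zero, Finset.sum_range] at h0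
        rw [h0]
        simp)
    simp at this
    omega

theorem CycBasis.reach_pow_mul (A : CycBasis F D r k) (hr : 2 ≤ r) (e : ℕ) (q : X → D) :
    Reach (coords A.basis q) (coords A.basis fun x => A.z ^ e * q x)
      (2 * r * ((r - 1) * r ^ k)) := by
  have := Reach.coords_sparse (P := coords A.basis q) (B := A.basis) (B' := A.basis)
    (LinearMap.mulLeft F (A.z ^ e)) (k := r) (q := q)
    (fun l s hs => A.card_support_pow_le hr (e + l) s (by
      simpa [A.basis_apply, pow_add] using hs)) subset_rfl
  simpa using this

/-- The coefficient of `z ^ e`. -/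
noncomputable def CycBasis.coeff (A : CycBasis F D r k) (v : D) (e : ℕ) : F :=
  if h : e < (r - 1) * r ^ k then A.basis.repr v ⟨e, h⟩ else 0

theorem CycBasis.sum_coeff (A : CycBasis F D r k) (v : D) {n : ℕ} (hn : (r - 1) * r ^ k ≤ n) :
    ∑ e ∈ Finset.range n, A.coeff v e • A.z ^ e = v := by
  rw [← Finset.sum_subset (Finset.range_mono hn)]
  · rw [Finset.sum_range]
    conv_rhs => rw [← A.basis.sum_repr v]
    exact Finset.sum_congr rfl fun i _ => by simp [CycBasis.coeff, A.basis_apply]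
  · intro e _ he
    simp only [Finset.mem_range] at he
    simp [CycBasis.coeff, he]

theorem CycBasis.repr_sum (A : CycBasis F D r k) {n : ℕ} (hn : n ≤ (r - 1) * r ^ k) (c : ℕ → F)
    (l : Fin ((r - 1) * r ^ k)) :
    A.basis.repr (∑ i ∈ Finset.range n, c i • A.z ^ i) l = if (l : ℕ) < n then c l else 0 := by
  have : ∑ i ∈ Finset.range n, c i • A.z ^ i =
      ∑ i : Fin ((r - 1) * r ^ k), (if (i : ℕ) < n then c i else 0) • A.basis i := by
    rw [← Finset.sum_range (n := (r - 1) * r ^ k)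
      (fun i => (if i < n then c i else 0) • A.z ^ i) |>.trans
        (Finset.sum_congr rfl fun i _ => by rw [A.basis_apply])]
    rw [← Finset.sum_subset (Finset.range_mono hn)]
    · exact Finset.sum_congr rfl fun i hi => by rw [if_pos (Finset.mem_range.1 hi)]
    · intro i _ hi
      rw [if_neg (by simpa using hi), zero_smul]
  rw [this, A.basis.repr_sum_self]

/-- The `u`-th block of `m` coefficients, as a polynomial in `z`. -/
noncomputable def CycBasis.block {E : Type*} [CommRing E] [Algebra F E] (A : CycBasis F D r k) (m u : ℕ) (z : E)
    (v : D) : E :=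
  ∑ i ∈ Finset.range m, A.coeff v (m * u + i) • z ^ i

theorem CycBasis.sum_block (A : CycBasis F D r k) (v : D) {m n : ℕ}
    (hn : (r - 1) * r ^ k ≤ m * n) :
    ∑ u ∈ Finset.range n, A.z ^ (m * u) * A.block m u A.z v = v := by
  conv_rhs => rw [← A.sum_coeff v hn, sum_range_mul_eq, Finset.sum_comm]
  refine Finset.sum_congr rfl fun u _ => ?_
  rw [CycBasis.block, Finset.mul_sum]
  exact Finset.sum_congr rfl fun i _ => by rw [mul_smul_comm, ← pow_add]

end CycBasis

/-! ### The convolution kernel of the cyclotomic quotient -/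

section Kernel

theorem dvd_add_pred_mul_iff {M N : ℕ} (hM : M ∣ N) (hN : 0 < N) (s i : ℕ) :
    M ∣ s + (N - 1) * i ↔ i % M = s % M := by
  obtain ⟨N, rfl⟩ : ∃ n, N = n + 1 := ⟨N - 1, by omega⟩
  obtain ⟨q, hq⟩ := hM
  rw [Nat.add_sub_cancel, show i % M = s % M ↔ i ≡ s [MOD M] from Iff.rfl, Nat.modEq_iff_dvd]
  zify at hq ⊢
  rw [show (s : ℤ) + N * i = (s - i) + (N + 1) * i by ring, hq]
  constructor
  · intro h
    exact (dvd_add_left (Dvd.intro (q * i : ℤ) (by ring))).1 h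
  · intro h
    exact dvd_add h (Dvd.intro (q * i : ℤ) (by ring))

variable {F D : Type*} [Field F] [CommRing D] [Algebra F D]

/-- The convolution kernel of the idempotent that projects
`D[y] / (y ^ r ^ (b + 1) - 1)` to its quotient by `1 + y ^ t + ⋯ + y ^ ((r - 1) t)`, `t = r ^ b`. -/
noncomputable def cycKernel (F : Type*) [Field F] (r b s : ℕ) : F :=
  (if r ^ (b + 1) ∣ s then 1 else 0) - if r ^ b ∣ s then (r : F)⁻¹ else 0

/-- The sum over `j` prime to `r` is the full sum minus the sum over multiples of `r`; the latter is
the full sum for `ω ^ r`, and orthogonality evaluates both. -/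
theorem sum_filter_not_dvd_eq_cycKernel {r b : ℕ} (hr : r.Prime) (hrF : (r : F) ≠ 0) {ω : D}
    (h : IsPrincipalRoot ω r (b + 1)) (s : ℕ) :
    ((r : F) ^ (b + 1))⁻¹ • ∑ j ∈ (Finset.range (r ^ (b + 1))).filter (fun j => ¬ r ∣ j),
      ω ^ (s * j) = algebraMap F D (cycKernel F r b s) := by
  have h1 := h.sum_pow hr s
  have h2 := h.pow.sum_pow hr s
  have h3 : ∑ j ∈ (Finset.range (r ^ (b + 1))).filter (fun j => r ∣ j), ω ^ (s * j) =
      ∑ j ∈ Finset.range (r ^ b), (ω ^ r) ^ (s * j) := by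
    symm
    refine Finset.sum_bij (fun j _ => r * j) ?_ ?_ ?_ ?_
    · intro j hj
      simp only [Finset.mem_filter, Finset.mem_range, dvd_mul_right, and_true] at *
      rw [pow_succ']
      exact Nat.mul_lt_mul_of_pos_left hj hr.pos
    · intro i _ j _ hij
      exact Nat.eq_of_mul_eq_mul_left hr.pos hij
    · intro j hj
      simp only [Finset.mem_filter, Finset.mem_range] at hj
      obtain ⟨hj, i, rfl⟩ := hj
      rw [pow_succ'] at hj
      exact ⟨i, Finset.mem_range.2 (Nat.lt_of_mul_lt_mul_left hj), rfl⟩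
    · intro j _
      rw [← pow_mul]
      congr 1
      ring
  have h4 := Finset.sum_filter_add_sum_filter_not (Finset.range (r ^ (b + 1)))
    (fun j => r ∣ j) (fun j => ω ^ (s * j))
  rw [h3, h1, h2, ← eq_sub_iff_add_eq'] at h4
  rw [h4]
  have hc : ((r : D) : D) = algebraMap F D r := (map_natCast _ r).symm
  rw [cycKernel, hc, Algebra.smul_def, map_sub, mul_sub]
  congr 1
  · split_ifs
    · rw [← map_pow, ← map_mul, inv_mul_cancel₀ (pow_ne_zero _ hrF)]
    · simp
  · split_ifs
    · rw [← map_pow, ← map_mul]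
      congr 1
      rw [pow_succ]
      field_simp
    · simp

/-- The first term of the kernel reproduces `y ^ s`; the second sums `y ^ i` over a class modulo `r
^ b` and vanishes by the cyclotomic relation. So convolution with this kernel is correct once `y` is
a principal root, although it differs from cyclic convolution. -/
theorem IsPrincipalRoot.sum_cycKernel_smul_pow {r b : ℕ} (hr : r.Prime) {y : D}
    (h : IsPrincipalRoot y r (b + 1)) (s : ℕ) :
    ∑ i ∈ Finset.range (r ^ (b + 1)), cycKernel F r b (s + (r ^ (b + 1) - 1) * i) • y ^ i =
      y ^ s := by
  have hN : 0 < r ^ (b + 1) := pow_pos hr.pos _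
  simp only [cycKernel, sub_smul, Finset.sum_sub_distrib, dvd_add_pred_mul_iff dvd_rfl hN,
    dvd_add_pred_mul_iff (pow_dvd_pow r (Nat.le_succ b)) hN, ite_smul, zero_smul, one_smul]
  have h1 : ∑ i ∈ Finset.range (r ^ (b + 1)),
      (if i % r ^ (b + 1) = s % r ^ (b + 1) then y ^ i else 0) = y ^ s := by
    rw [Finset.sum_eq_single (s % r ^ (b + 1))]
    · rw [if_pos (Nat.mod_mod _ _), ← pow_eq_pow_mod s h.1]
    · intro i hi hne
      rw [if_neg]
      rwa [Nat.mod_eq_of_lt (Finset.mem_range.1 hi)]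
    · intro hn
      exact absurd (Finset.mem_range.2 (Nat.mod_lt _ hN)) hn
  have h2 : ∑ i ∈ Finset.range (r ^ (b + 1)),
      (if i % r ^ b = s % r ^ b then (r : F)⁻¹ • y ^ i else 0) = 0 := by
    rw [pow_succ, sum_range_mul_eq]
    refine Finset.sum_eq_zero fun i₀ _ => ?_
    simp only [Nat.mul_add_mod]
    split_ifs
    · have := h.2 b rfl
      simp only [pow_add, ← Finset.smul_sum, ← Finset.sum_mul, mul_comm (r ^ b), this, zero_mul,
        smul_zero]
    · simp
  rw [h1, h2, sub_zero]

/-- The number of recursive multiplications. Saving the fraction `1 / r` of them by the mask is what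
gives the recursion the factor 2 per coordinate, hence a single logarithm. -/
theorem card_filter_not_dvd {r : ℕ} (hr : 0 < r) (b : ℕ) :
    ((Finset.range (r ^ (b + 1))).filter (fun j => ¬ r ∣ j)).card ≤ (r - 1) * r ^ b := by
  have h : ((Finset.range (r ^ (b + 1))).filter (fun j => r ∣ j)).card = r ^ b := by
    have : (Finset.range (r ^ (b + 1))).filter (fun j => r ∣ j) =
        (Finset.range (r ^ b)).image (fun j => r * j) := by
      ext j
      simp only [Finset.mem_filter, Finset.mem_range, Finset.mem_image]
      constructor
      · rintro ⟨hj, i, rfl⟩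
        rw [pow_succ'] at hj
        exact ⟨i, Nat.lt_of_mul_lt_mul_left hj, rfl⟩
      · rintro ⟨i, hi, rfl⟩
        rw [pow_succ']
        exact ⟨Nat.mul_lt_mul_of_pos_left hi hr, dvd_mul_right _ _⟩
    rw [this, Finset.card_image_of_injective _ (fun _ _ h => Nat.eq_of_mul_eq_mul_left hr h),
      Finset.card_range]
  have h' := Finset.card_filter_add_card_filter_not (s := Finset.range (r ^ (b + 1)))
    (fun j => r ∣ j)
  rw [h, Finset.card_range] at h'
  have := pow_succ' r b
  rw [Nat.sub_mul, one_mul]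
  omega

end Kernel

/-! ### The recursive multiplication step -/

section SchonhageStrassen

variable {F X A D : Type*} [Field F] [CommRing A] [Algebra F A] [CommRing D] [Algebra F D]
  {r a b k : ℕ}

/-- Replace `z` by the root of another algebra in a polynomial of small degree. -/
noncomputable def CycBasis.subst (𝓓 : CycBasis F D r k) (z : A) : D →ₗ[F] A :=
  𝓓.basis.constr F fun l => z ^ (l : ℕ)

theorem CycBasis.subst_pow (𝓓 : CycBasis F D r k) (z : A) {e : ℕ} (he : e < (r - 1) * r ^ k) :
    𝓓.subst z (𝓓.z ^ e) = z ^ e := by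
  have := 𝓓.basis.constr_basis F (fun l => z ^ (l : ℕ)) ⟨e, he⟩
  rwa [𝓓.basis_apply] at this

/-- `subst` is only linear, but two blocks of length `m` have a product of degree below `2 * m`, the
dimension of `D`, so nothing is reduced in `D`. -/
theorem CycBasis.subst_block_mul_block (𝓐 : CycBasis F A r (a + b)) (𝓓 : CycBasis F D r k)
    {m : ℕ} (hd : (r - 1) * r ^ k = 2 * m) (u u' : ℕ) (v w : A) :
    𝓓.subst 𝓐.z (𝓐.block m u 𝓓.z v * 𝓐.block m u' 𝓓.z w) =
      𝓐.block m u 𝓐.z v * 𝓐.block m u' 𝓐.z w := by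
  simp only [CycBasis.block, Finset.sum_mul_sum, map_sum]
  refine Finset.sum_congr rfl fun i hi => Finset.sum_congr rfl fun j hj => ?_
  rw [Finset.mem_range] at hi hj
  rw [smul_mul_smul_comm, smul_mul_smul_comm, ← pow_add, ← pow_add, map_smul,
    𝓓.subst_pow _ (by omega)]

theorem CycBasis.coords_block_subset (𝓐 : CycBasis F A r (a + b)) (𝓓 : CycBasis F D r k)
    {m : ℕ} (hd : (r - 1) * r ^ k = 2 * m) (u : ℕ) (q : X → A) :
    coords 𝓓.basis (fun x => 𝓐.block m u 𝓓.z (q x)) ⊆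
      coords 𝓐.basis q ∪ Set.range fun (c : F) (_ : X) => c := by
  rintro _ ⟨l, rfl⟩
  simp only [CycBasis.block, 𝓓.repr_sum (show m ≤ _ by omega)]
  by_cases h : (l : ℕ) < m ∧ m * u + l < (r - 1) * r ^ (a + b)
  · left
    refine ⟨⟨m * u + l, h.2⟩, ?_⟩
    ext x
    simp [h.1, CycBasis.coeff, h.2]
  · right
    refine ⟨0, ?_⟩
    ext x
    by_cases h1 : (l : ℕ) < m
    · have h2 : ¬ m * u + l < (r - 1) * r ^ (a + b) := fun h' => h ⟨h1, h'⟩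
      simp only [h1, if_true, CycBasis.coeff, h2, dif_neg, not_false_eq_true]
    · simp [h1]

/-- Write both factors in blocks as polynomials in `y = z ^ r ^ a`, a principal root of order `r ^
(b + 1)`. Multiply block by block in `D`, convolve with the kernel, and substitute back. -/
theorem CycBasis.mul_eq_sum_subst (𝓐 : CycBasis F A r (a + b)) (𝓓 : CycBasis F D r k)
    (hr : r.Prime) (hd : (r - 1) * r ^ k = 2 * r ^ a) (v w : A) :
    ∑ i ∈ Finset.range (r ^ (b + 1)), 𝓐.z ^ (r ^ a * i) * 𝓓.subst 𝓐.z
      (∑ u ∈ Finset.range (r ^ (b + 1)), ∑ u' ∈ Finset.range (r ^ (b + 1)),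
        cycKernel F r b (u + u' + (r ^ (b + 1) - 1) * i) •
          (𝓐.block (r ^ a) u 𝓓.z v * 𝓐.block (r ^ a) u' 𝓓.z w)) = v * w := by
  set m := r ^ a
  set N := r ^ (b + 1)
  have hy : IsPrincipalRoot (𝓐.z ^ m) r (b + 1) :=
    IsPrincipalRoot.pow_pow a (by
      have := 𝓐.isPrincipalRoot
      rwa [show a + b + 1 = b + 1 + a by ring] at this)
  have hn : (r - 1) * r ^ (a + b) ≤ m * N := by
    rw [← pow_add, ← add_assoc, pow_succ']
    exact Nat.mul_le_mul_right _ (Nat.sub_le r 1)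
  simp only [map_sum, map_smul, 𝓐.subst_block_mul_block 𝓓 hd, Finset.mul_sum]
  rw [Finset.sum_comm]
  conv_rhs => rw [← 𝓐.sum_block v hn, ← 𝓐.sum_block w hn, Finset.sum_mul_sum]
  refine Finset.sum_congr rfl fun u _ => ?_
  rw [Finset.sum_comm]
  refine Finset.sum_congr rfl fun u' _ => ?_
  have := hy.sum_cycKernel_smul_pow (F := F) hr (u + u')
  rw [mul_mul_mul_comm, ← pow_add, ← mul_add, pow_mul, ← this, Finset.sum_mul]
  refine Finset.sum_congr rfl fun i _ => ?_
  rw [mul_smul_comm, smul_mul_assoc, pow_mul]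

/-- The recursive step of the Schönhage–Strassen algorithm. -/
theorem CycBasis.reach_mul_step (𝓐 : CycBasis F A r (a + b)) (𝓓 : CycBasis F D r k)
    (hr : r.Prime) (hrF : (r : F) ≠ 0) (hd : (r - 1) * r ^ k = 2 * r ^ a) (hb : b ≤ k) {T : ℕ}
    (hT : ∀ (c : D) (q : X → D), Reach (coords 𝓓.basis q) (coords 𝓓.basis fun x => c * q x) T)
    (c : A) (q : X → A) :
    Reach (coords 𝓐.basis q) (coords 𝓐.basis fun x => c * q x)
      (2 * ((b + 1) * r ^ (b + 2) * (2 * r * (2 * r ^ a) + 2 * r ^ a)) + (r - 1) * r ^ b * T +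
        2 * r * (r ^ (b + 1) * (2 * r ^ a))) := by
  set m := r ^ a with hm
  set N := r ^ (b + 1) with hN
  -- The root needed for a transform of length `r ^ (b + 1)` exists in `D` because `b ≤ k`; it is a
  -- power of `𝓓.z`, so its powers act sparsely.
  set ω : D := 𝓓.z ^ r ^ (k - b) with hω
  have hω' : IsPrincipalRoot ω r (b + 1) :=
    IsPrincipalRoot.pow_pow (k - b) (by
      have := 𝓓.isPrincipalRoot
      rwa [show k + 1 = b + 1 + (k - b) by omega] at this)
  set J := (Finset.range N).filter (fun j => ¬ r ∣ j) with hJ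
  set C : ℕ → D := fun j => ((r : F) ^ (b + 1))⁻¹ • ∑ u ∈ Finset.range N, ω ^ (u * j) *
    𝓐.block m u 𝓓.z c with hC
  set V : ℕ → X → D := fun u x => 𝓐.block m u 𝓓.z (q x) with hV
  have h1 : Reach (coords 𝓐.basis q) (⋃ i ∈ Finset.range N, coords 𝓓.basis (V i)) 0 := by
    refine Reach.drop_consts (Reach.of_subset ?_)
    exact Set.iUnion₂_subset fun u _ => 𝓐.coords_block_subset 𝓓 hd u q
  have h2 := Reach.maskedConv (B := 𝓓.basis) r (2 * r * (2 * m)) (b + 1) T hω'.1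
    (fun e q => by
      rw [hω, ← pow_mul, ← hd]
      exact 𝓓.reach_pow_mul hr.two_le (r ^ (k - b) * e) q)
    (J := J) (Finset.filter_subset _ _) C (fun j _ q => hT (C j) q) V
  set W : ℕ → X → D := fun i x => ∑ j ∈ J, (ω ^ (N - 1)) ^ (j * i) *
        (C j * ∑ u ∈ Finset.range N, ω ^ (u * j) * V u x) with hW
  have hWeq : ∀ x, ∑ i ∈ Finset.range N, 𝓐.z ^ (m * i) * 𝓓.subst 𝓐.z (W i x) = c * q x := by
    intro x
    rw [← 𝓐.mul_eq_sum_subst 𝓓 hr hd c (q x)]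
    refine Finset.sum_congr rfl fun i _ => ?_
    congr 2
    exact masked_conv_eq ω J _ (cycKernel F r b)
      (fun s => sum_filter_not_dvd_eq_cycKernel hr hrF hω' s) _ _ i
  -- Overlapping blocks are added up by one sparse matrix: each of the `N * (2 * m)` coordinates
  -- contributes a multiple of a power of `𝓐.z`.
  have h3 : Reach (⋃ i ∈ Finset.range N, coords 𝓓.basis (W i))
      (coords 𝓐.basis fun x => c * q x) (2 * r * (N * (2 * m))) := by
    have := Reach.sparse (P := ⋃ i ∈ Finset.range N, coords 𝓓.basis (W i))
      (J := Fin N × Fin ((r - 1) * r ^ k)) (O := Fin ((r - 1) * r ^ (a + b)))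
      (fun o p => 𝓐.basis.repr (𝓐.z ^ (m * p.1 + p.2)) o)
      (q := fun p x => 𝓓.basis.repr (W p.1 x) p.2)
      (fun p => Set.mem_biUnion (Finset.mem_range.2 p.1.2) (mem_coords (W p.1) p.2))
      (k := r) (fun p s hs => 𝓐.card_support_pow_le hr.two_le _ s hs)
    refine (this.mono_right ?_).mono_ops (by simp [hd])
    rintro _ ⟨o, rfl⟩
    refine ⟨o, ?_⟩
    ext x
    change ∑ p : Fin N × Fin ((r - 1) * r ^ k), 𝓐.basis.repr (𝓐.z ^ (m * p.1 + p.2)) o *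
      𝓓.basis.repr (W p.1 x) p.2 = 𝓐.basis.repr (c * q x) o
    rw [← hWeq x, Fintype.sum_prod_type, Finset.sum_range]
    simp only [map_sum, Finsupp.coe_finsetSum, Finset.sum_apply]
    refine Finset.sum_congr rfl fun i _ => ?_
    conv_rhs => rw [← 𝓓.basis.sum_repr (W i x)]
    simp only [map_sum, map_smul, Finset.mul_sum, Finsupp.coe_finsetSum, Finset.sum_apply,
      𝓓.basis_apply]
    refine Finset.sum_congr rfl fun l _ => ?_
    rw [𝓓.subst_pow _ l.2, mul_smul_comm, ← pow_add, map_smul, Finsupp.smul_apply, smul_eq_mul,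
      mul_comm]
  refine ((h1.trans h2).trans h3).mono_ops ?_
  rw [Fintype.card_fin, hd, zero_add]
  gcongr
  exact card_filter_not_dvd hr.pos b

end SchonhageStrassen

/-! ### Fast multiplication and Toeplitz matrices -/

section FastMultiplication

variable {F : Type u} [Field F] {X : Type*}

theorem CycBasis.reach_mul_naive {A : Type*} [CommRing A] [Algebra F A] {r k : ℕ}
    (𝓐 : CycBasis F A r k) (c : A) (q : X → A) :
    Reach (coords 𝓐.basis q) (coords 𝓐.basis fun x => c * q x)
      (2 * ((r - 1) * r ^ k) * ((r - 1) * r ^ k)) := by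
  have := Reach.coords_sparse (P := coords 𝓐.basis q) (B := 𝓐.basis) (B' := 𝓐.basis)
    (LinearMap.mulLeft F c) (k := (r - 1) * r ^ k) (q := q)
    (fun l s _ => by simpa using s.card_le_univ) subset_rfl
  simpa using this

/-- The recursion passes from `k` to `k / 2 + 1`, with fixed point 2; in the variable `k - 2` it is
halving. The term `288 * k` covers transforms and recombination per coordinate. -/
theorem log_recurrence {k : ℕ} (hk : 3 ≤ k) :
    2 * (36 + 936 * ((k / 2 + 1 - 2) * (Nat.log 2 (k / 2 + 1 - 2) + 1))) + 288 * k ≤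
      36 + 936 * ((k - 2) * (Nat.log 2 (k - 2) + 1)) := by
  obtain ⟨j, rfl⟩ : ∃ j, k = j + 2 := ⟨k - 2, by omega⟩
  rw [show (j + 2) / 2 + 1 - 2 = j / 2 by omega, show j + 2 - 2 = j by omega]
  rcases (show j = 1 ∨ 2 ≤ j by omega) with rfl | hj
  · simp
  · have h1 : Nat.log 2 (j / 2) + 1 = Nat.log 2 j := by
      rw [Nat.log_div_base]
      have := Nat.log_pos one_lt_two hj
      omega
    rw [h1]
    have h2 : 2 * (j / 2 * Nat.log 2 j) ≤ j * Nat.log 2 j := by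
      rw [← mul_assoc]
      exact Nat.mul_le_mul_right _ (Nat.mul_div_le j 2)
    have h3 : j * (Nat.log 2 j + 1) = j * Nat.log 2 j + j := by ring
    omega

/-- The Schönhage–Strassen algorithm, with radix two or three. -/
theorem CycBasis.reach_mul {r : ℕ} (hr : r = 2 ∨ r = 3) (hrF : (r : F) ≠ 0) (k : ℕ) :
    ∀ {A : Type u} [CommRing A] [Algebra F A] (𝓐 : CycBasis F A r k) (c : A) (q : X → A),
      Reach (coords 𝓐.basis q) (coords 𝓐.basis fun x => c * q x)
        ((r - 1) * r ^ k * (36 + 936 * ((k - 2) * (Nat.log 2 (k - 2) + 1)))) := by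
  induction k using Nat.strong_induction_on with
  | _ k ih =>
  intro A _ _ 𝓐 c q
  have hp : r.Prime := by
    rcases hr with rfl | rfl
    · exact Nat.prime_two
    · exact Nat.prime_three
  rcases lt_or_ge k 3 with hk | hk
  · refine (𝓐.reach_mul_naive c q).mono_ops ?_
    -- The worst case is `2 * 3 ^ 2`; the naive cost per coordinate is then at most `36`, the
    -- constant in the bound.
    have h18 : (r - 1) * r ^ k ≤ 18 := by
      interval_cases k <;> rcases hr with rfl | rfl <;> norm_num
    calc _ = (r - 1) * r ^ k * (2 * ((r - 1) * r ^ k)) := by ring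
      _ ≤ _ := Nat.mul_le_mul_left _ (by omega)
  · obtain ⟨D, _, _, ⟨𝓓⟩⟩ := exists_cycBasis F hp.two_le (k / 2 + 1)
    have hT := fun c q => ih (k / 2 + 1) (by omega) 𝓓 c q
    have hrec := log_recurrence hk
    set g := 36 + 936 * ((k / 2 + 1 - 2) * (Nat.log 2 (k / 2 + 1 - 2) + 1)) with hg
    rcases hr with rfl | rfl
    -- The inner algebra must have dimension twice the block length. Exponent `k / 2 + 1` achieves
    -- this with `a = k / 2` for radix 2 and with `a = k / 2 + 1` for radix 3.
    · obtain ⟨b, hb, hbk⟩ : ∃ b, k = k / 2 + b ∧ b + 1 ≤ k := ⟨k - k / 2, by omega, by omega⟩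
      generalize ha : k / 2 = a at *
      subst hb
      refine (𝓐.reach_mul_step 𝓓 hp hrF (by simp [pow_succ']) (by omega) hT c q).mono_ops ?_
      refine le_trans ?_ (Nat.mul_le_mul_left _ hrec)
      simp only [pow_add, pow_one]
      generalize 2 ^ a = m
      generalize 2 ^ b = t
      have : m * t * (b + 1) ≤ m * t * (a + b) := Nat.mul_le_mul_left _ hbk
      nlinarith [Nat.zero_le (m * t * b)]
    · obtain ⟨b, hb, hbk⟩ : ∃ b, k = k / 2 + 1 + b ∧ b + 1 ≤ k :=
        ⟨k - (k / 2 + 1), by omega, by omega⟩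
      generalize ha : k / 2 + 1 = a at *
      subst hb
      refine (𝓐.reach_mul_step 𝓓 hp hrF rfl (by omega) hT c q).mono_ops ?_
      refine le_trans ?_ (Nat.mul_le_mul_left _ hrec)
      simp only [pow_add, pow_one]
      generalize 3 ^ a = m
      generalize 3 ^ b = t
      have : m * t * (b + 1) ≤ m * t * (a + b) := Nat.mul_le_mul_left _ hbk
      nlinarith [Nat.zero_le (m * t * b)]

/-- The product of a vector with a constant Toeplitz matrix of size `2 ^ k` costs `μ 2 ^ k`. -/
def FastToeplitz (F X : Type*) [Field F] (μ k : ℕ) : Prop :=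
  ∀ (s : ℤ → F) (a : ℕ → X → F),
    Reach (a '' {u | u < 2 ^ k})
      ((fun (t : ℕ) x => ∑ u ∈ Finset.range (2 ^ k), s (t - u) * a u x) '' {t | t < 2 ^ k})
      (μ * 2 ^ k)

/-- The product is a window of a polynomial product with factors of lengths `2 * h` and `h`. In an
algebra of dimension at least `3 * h` this product is not reduced. -/
theorem fastToeplitz (F : Type u) [Field F] (X : Type*) (k : ℕ) :
    FastToeplitz F X (18 * (36 + 936 * (k * (Nat.log 2 k + 1)))) k := by
  intro s a
  -- The radix must be invertible in `F`: 2 unless the characteristic is 2, and then 3.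
  obtain ⟨r, hr, hrF⟩ : ∃ r : ℕ, (r = 2 ∨ r = 3) ∧ (r : F) ≠ 0 := by
    by_cases h : ((2 : ℕ) : F) = 0
    · refine ⟨3, Or.inr rfl, ?_⟩
      rw [show (3 : ℕ) = 2 + 1 from rfl, Nat.cast_add, h]
      simp
    · exact ⟨2, Or.inl rfl, h⟩
  have hr2 : 2 ≤ r := by omega
  set h := 2 ^ k with hh
  have hpos : 0 < h := by positivity
  set κ := Nat.clog r (3 * h) with hκ
  have h1 : 3 * h ≤ r ^ κ := Nat.le_pow_clog (by omega) _
  have h2 : r ^ κ ≤ 3 * r * h := by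
    have hκ0 : κ ≠ 0 := fun h0 => by simp [h0] at h1; omega
    have := Nat.pow_pred_clog_lt_self (b := r) (by omega) (x := 3 * h) (by omega)
    rw [← hκ] at this
    calc r ^ κ = r ^ (κ - 1) * r := by rw [← pow_succ, Nat.sub_add_cancel (by omega)]
      _ ≤ 3 * h * r := Nat.mul_le_mul_right _ this.le
      _ = _ := by ring
  have h3 : κ ≤ k + 2 := by
    refine Nat.clog_le_of_le_pow ?_
    calc 3 * h ≤ 2 ^ (k + 2) := by rw [pow_add, ← hh]; omega
      _ ≤ r ^ (k + 2) := Nat.pow_le_pow_left hr2 _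
  have h4 : 3 * h ≤ (r - 1) * r ^ κ := h1.trans (Nat.le_mul_of_pos_left _ (by omega))
  obtain ⟨D, _, _, ⟨𝓓⟩⟩ := exists_cycBasis F hr2 κ
  -- The shift by `h - 1` makes the indices nonnegative; output `t` is the coefficient at `t + (h -
  -- 1)`.
  set c : D := ∑ j ∈ Finset.range (2 * h), s (j - (h - 1 : ℕ)) • 𝓓.z ^ j with hc
  set q : X → D := fun x => ∑ u ∈ Finset.range h, a u x • 𝓓.z ^ u with hq
  have hmul := CycBasis.reach_mul hr hrF κ 𝓓 c q
  have hin : Reach (a '' {u | u < h}) (coords 𝓓.basis q) 0 := by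
    refine Reach.drop_consts (Reach.of_subset ?_)
    rintro _ ⟨l, rfl⟩
    simp only [hq, 𝓓.repr_sum (show h ≤ _ by omega)]
    by_cases hl : (l : ℕ) < h
    · exact Or.inl ⟨l, hl, by simp [hl]⟩
    · exact Or.inr ⟨0, by simp [hl]⟩
  refine ((hin.trans hmul).mono_right ?_).mono_ops ?_
  · rintro _ ⟨t, ht, rfl⟩
    rw [Set.mem_ofPred_eq] at ht
    refine ⟨⟨t + (h - 1), by omega⟩, ?_⟩
    ext x
    simp only [hc, hq, Finset.sum_mul_sum, smul_mul_smul_comm, ← pow_add, map_sum, map_smul,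
      Finsupp.coe_finsetSum, Finset.sum_apply, Finsupp.smul_apply, smul_eq_mul]
    rw [Finset.sum_comm]
    refine Finset.sum_congr rfl fun u hu => ?_
    rw [Finset.mem_range] at hu
    have hrepr : ∀ j < 2 * h, 𝓓.basis.repr (𝓓.z ^ (j + u)) ⟨t + (h - 1), by omega⟩ =
        if j + u = t + (h - 1) then 1 else 0 := fun j hj => by
      rw [← 𝓓.basis_apply ⟨j + u, by omega⟩, 𝓓.basis.repr_self, Finsupp.single_apply]
      simp [Fin.ext_iff]
    rw [Finset.sum_eq_single (t + (h - 1) - u)]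
    · rw [hrepr _ (by omega), if_pos (by omega), mul_one]
      congr 2
      omega
    · intro j hj hne
      rw [hrepr j (Finset.mem_range.1 hj), if_neg (by omega), mul_zero]
    · intro hn
      exact absurd (Finset.mem_range.2 (by omega)) hn
  · rw [zero_add]
    have h5 : (r - 1) * r ^ κ ≤ 18 * h := by
      rcases hr with rfl | rfl <;> omega
    calc _ ≤ 18 * h * (36 + 936 * (k * (Nat.log 2 k + 1))) := by
          gcongr
          · omega
          · omega
      _ = _ := by ring

/-- Toeplitz matrices through the discrete Fourier transform. -/
theorem fastToeplitz_of_isPrimitiveRoot {F : Type*} [Field F] (X : Type*) {k : ℕ} {ω : F}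
    (hω : IsPrimitiveRoot ω (2 ^ (k + 1))) : FastToeplitz F X (16 * (k + 1) + 2) k := by
  intro s a
  set h := 2 ^ k with hh
  have hpos : 0 < h := by positivity
  have hN : 2 ^ (k + 1) = 2 * h := by rw [pow_succ']
  have hneg : ω ^ h = -1 := by
    have h2 : IsPrimitiveRoot (ω ^ h) 2 := hω.pow (by positivity) (by rw [hN, mul_comm])
    exact h2.eq_neg_one_of_two_right
  have hpr : IsPrincipalRoot ω 2 (k + 1) := by
    refine .of_sum_eq_zero ?_
    simp [Finset.sum_range_succ, ← hh, hneg]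
  have h2F : ((2 : ℕ) : F) ^ (k + 1) ≠ 0 := by
    have := hω.neZero'
    exact_mod_cast this.out
  set B : Module.Basis Unit F F := Module.Basis.singleton Unit F with hB
  have hcoords : ∀ q : X → F, coords B q = {q} := fun q => by
    ext v
    simp [coords, hB, Set.mem_singleton_iff, eq_comm]
  -- The transform of the circulant of size `2 * h` in which the Toeplitz matrix is embedded: the
  -- upper half of its first column carries the negative indices.
  set C : ℕ → F := fun j => (((2 : ℕ) : F) ^ (k + 1))⁻¹ • ∑ u ∈ Finset.range (2 ^ (k + 1)),
    ω ^ (u * j) * (if u < h then s u else s (u - (2 * h : ℕ))) with hC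
  set P : ℕ → X → F := fun u x => if u < h then a u x else 0 with hP
  have key := Reach.maskedConv (B := B) 2 1 (k + 1) 1 hpr.1
    (fun e q => by
      rw [hcoords, hcoords]
      exact Reach.const_mul (Set.mem_singleton _) _)
    (J := Finset.range (2 ^ (k + 1))) subset_rfl C
    (fun j _ q => by
      rw [hcoords, hcoords]
      exact Reach.const_mul (Set.mem_singleton _) _) P
  simp only [hcoords] at key
  have hin : Reach (a '' {u | u < h}) (⋃ i ∈ Finset.range (2 ^ (k + 1)), {P i}) 0 := by
    refine Reach.drop_consts (Reach.of_subset (Set.iUnion₂_subset fun u _ => ?_))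
    rintro _ rfl
    by_cases hu : u < h
    · exact Or.inl ⟨u, hu, by simp [hP, hu]⟩
    · exact Or.inr ⟨0, by simp [hP, hu]⟩
  refine ((hin.trans key).mono_right ?_).mono_ops ?_
  · rintro _ ⟨t, ht, rfl⟩
    rw [Set.mem_ofPred_eq] at ht
    refine Set.mem_biUnion (Finset.mem_range.2 (show t < 2 ^ (k + 1) by omega)) ?_
    rw [Set.mem_singleton_iff]
    ext x
    have hκ : ∀ v, (((2 : ℕ) : F) ^ (k + 1))⁻¹ • ∑ j ∈ Finset.range (2 ^ (k + 1)), ω ^ (v * j) =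
        algebraMap F F (if 2 ^ (k + 1) ∣ v then 1 else 0) := fun v => by
      rw [hpr.sum_pow Nat.prime_two v]
      split_ifs
      · simpa using inv_mul_cancel₀ h2F
      · simp
    have hconv := masked_conv_eq (N := 2 ^ (k + 1)) ω (Finset.range (2 ^ (k + 1))) _ _ hκ
      (fun u => if u < h then s u else s (u - (2 * h : ℕ))) (fun u => P u x) t
    refine Eq.trans ?_ hconv.symm
    rw [Finset.sum_comm, ← Finset.sum_subset (Finset.range_mono (show h ≤ 2 ^ (k + 1) by omega))]
    · refine Finset.sum_congr rfl fun u hu => ?_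
      rw [Finset.mem_range] at hu
      have hdvd : ∀ i, 2 * h ∣ i + u + (2 * h - 1) * t ↔ t = (i + u) % (2 * h) :=
        fun i => by
          rw [dvd_add_pred_mul_iff dvd_rfl (by positivity), Nat.mod_eq_of_lt (by omega)]
      simp only [hP, if_pos hu, hN, hdvd]
      rw [Finset.sum_eq_single ((2 * h + t - u) % (2 * h))]
      · rcases le_or_gt u t with hut | hut
        · have e1 : (2 * h + t - u) % (2 * h) = t - u := by
            rw [show 2 * h + t - u = (t - u) + 2 * h by omega, Nat.add_mod_right,
              Nat.mod_eq_of_lt (by omega)]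
          have e2 : t = (t - u + u) % (2 * h) := by
            rw [Nat.sub_add_cancel hut, Nat.mod_eq_of_lt (by omega)]
          rw [e1, if_pos e2, if_pos (show t - u < h by omega), one_smul, Nat.cast_sub hut]
        · have e1 : (2 * h + t - u) % (2 * h) = 2 * h + t - u := Nat.mod_eq_of_lt (by omega)
          have e2 : t = (2 * h + t - u + u) % (2 * h) := by
            rw [show 2 * h + t - u + u = t + 2 * h by omega, Nat.add_mod_right,
              Nat.mod_eq_of_lt (by omega)]
          rw [e1, if_pos e2, if_neg (show ¬ 2 * h + t - u < h by omega), one_smul]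
          congr 2
          omega
      · intro i hi hne
        rw [Finset.mem_range] at hi
        rw [if_neg, zero_smul]
        intro h0
        apply hne
        rcases lt_or_ge (i + u) (2 * h) with hiu | hiu
        · rw [Nat.mod_eq_of_lt hiu] at h0
          rw [show 2 * h + t - u = i + 2 * h by omega, Nat.add_mod_right, Nat.mod_eq_of_lt hi]
        · rw [Nat.mod_eq_sub_mod hiu, Nat.mod_eq_of_lt (by omega)] at h0
          rw [show 2 * h + t - u = i by omega, Nat.mod_eq_of_lt hi]
      · intro hn
        exact absurd (Finset.mem_range.2 (Nat.mod_lt _ (by omega))) hn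
    · intro u _ hu
      rw [Finset.mem_range] at hu
      simp [hP, hu]
  · simp only [Fintype.card_unit, Finset.card_range]
    rw [pow_succ 2 (k + 1), hN]
    nlinarith

end FastMultiplication

/-! ### Product trees and Cauchy matrices -/

section Trees

variable {F X : Type*} [Field F]

/-- A block Toeplitz matrix, with `p × q` blocks of size `2 ^ k`. -/
theorem FastToeplitz.rect {μ k : ℕ} (hT : FastToeplitz F X μ k) (p q : ℕ) (s : ℤ → F)
    (a : ℕ → X → F) :
    Reach (a '' {u | u < q * 2 ^ k})
      ((fun (t : ℕ) x => ∑ u ∈ Finset.range (q * 2 ^ k), s (t - u) * a u x) ''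
        {t | t < p * 2 ^ k}) (p * q * ((μ + 1) * 2 ^ k)) := by
  set h := 2 ^ k with hh
  have hpos : 0 < h := by positivity
  set g : ℕ → ℕ → ℕ → X → F := fun i j t x =>
    ∑ u ∈ Finset.range h, s (((i * h + t : ℕ) : ℤ) - (j * h + u : ℕ)) * a (j * h + u) x with hg
  have h1 : ∀ i ∈ Finset.range p, Reach (a '' {u | u < q * h})
      (⋃ j ∈ Finset.range q, g i j '' {t | t < h}) (q * (μ * h)) := fun i _ => by
    refine Reach.of_forall (n := μ * h) (Finset.range q) (fun j hj => ?_) subset_rfl (by simp)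
    have := hT (fun n => s (n + ((i * h : ℕ) - (j * h : ℕ)))) (fun u => a (j * h + u))
    refine (this.mono_left ?_).mono_right ?_
    · rintro _ ⟨u, hu, rfl⟩
      refine ⟨j * h + u, ?_, rfl⟩
      simp only [Finset.mem_range, Set.mem_ofPred_eq] at hj hu ⊢
      nlinarith
    · rintro _ ⟨t, ht, rfl⟩
      refine ⟨t, ht, ?_⟩
      ext x
      refine Finset.sum_congr rfl fun u _ => ?_
      congr 2
      push_cast
      ring
  have h2 := Reach.of_forall (m := p * (q * (μ * h))) (Finset.range p) h1 subset_rfl (by simp)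
  refine (h2.trans (Reach.of_forall (m := p * h * q) (n := q) (Finset.range (p * h))
    (Q := fun t => {fun x => ∑ u ∈ Finset.range (q * h), s (t - u) * a u x})
    (fun t ht => ?_) ?_ (by simp))).mono_ops (le_of_eq (by ring))
  · have hi : t / h < p := by
      rw [Nat.div_lt_iff_lt_mul hpos]
      exact Finset.mem_range.1 ht
    have h3 := Reach.sum (n := fun _ => 0) (Finset.range q)
      (P := ⋃ i ∈ Finset.range p, ⋃ j ∈ Finset.range q, g i j '' {t | t < h})
      (q := fun j => g (t / h) j (t % h)) (fun j hj => Reach.of_subset (by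
        rintro _ rfl
        exact Set.mem_biUnion (Finset.mem_range.2 hi)
          (Set.mem_biUnion (Finset.mem_coe.2 hj) ⟨t % h, Nat.mod_lt _ hpos, rfl⟩)))
    convert h3 using 1
    · congr 1
      ext x
      simp only [hg, Nat.div_add_mod']
      rw [mul_comm q h, sum_range_mul_eq, Finset.sum_comm]
      simp only [mul_comm h]
    · simp
  · rintro _ ⟨t, ht, rfl⟩
    exact Set.mem_biUnion (Finset.mem_range.2 ht) rfl

theorem sum_antidiagonal_eq_toeplitz (a b : ℕ → F) {n t : ℕ}
    (ha : ∀ u, n ≤ u → u ≤ t → a u = 0) :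
    ∑ p ∈ Finset.HasAntidiagonal.antidiagonal t, a p.1 * b p.2 =
      ∑ u ∈ Finset.range n, (if (0 : ℤ) ≤ t - u then b ((t : ℤ) - u).toNat else 0) * a u := by
  rw [Finset.Nat.sum_antidiagonal_eq_sum_range_succ_mk]
  have e : ∀ u, u ≤ t → (if (0 : ℤ) ≤ t - u then b ((t : ℤ) - u).toNat else 0) * a u =
      a u * b (t - u) := fun u hu => by
    rw [if_pos (by omega), mul_comm, show ((t : ℤ) - u).toNat = t - u by omega]
  rcases le_total n (t + 1) with h | h
  · rw [← Finset.sum_subset (Finset.range_mono h)]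
    · exact Finset.sum_congr rfl fun u hu => (e u (by have := Finset.mem_range.1 hu; omega)).symm
    · intro u hu hn
      rw [Finset.mem_range] at hu hn
      simp [ha u (by omega) (by omega)]
  · rw [← Finset.sum_subset (Finset.range_mono h)]
    · exact Finset.sum_congr rfl fun u hu => (e u (by have := Finset.mem_range.1 hu; omega)).symm
    · intro u hu hn
      rw [Finset.mem_range] at hu hn
      rw [if_neg (by omega), zero_mul]

open Polynomial in
/-- `∏ (1 - x i Z)` over `i < 2 ^ k`. -/
noncomputable def denomTree (k : ℕ) (x : ℕ → F) : F[X] :=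
  ∏ i ∈ Finset.range (2 ^ k), (1 - C (x i) * Polynomial.X)

open Polynomial in
/-- The numerator of `∑ w i / (1 - x i Z)` over `i < 2 ^ k`. -/
noncomputable def numerTree : ℕ → (ℕ → F) → (ℕ → F) → F[X]
  | 0, _, w => C (w 0)
  | k + 1, x, w => numerTree k x w * denomTree k (fun i => x (i + 2 ^ k)) +
      numerTree k (fun i => x (i + 2 ^ k)) (fun i => w (i + 2 ^ k)) * denomTree k x

theorem natDegree_denomTree_le (k : ℕ) (x : ℕ → F) : (denomTree k x).natDegree ≤ 2 ^ k := by
  refine (Polynomial.natDegree_prod_le _ _).trans ?_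
  refine (Finset.sum_le_card_nsmul _ _ 1 fun i _ => ?_).trans (by simp)
  compute_degree

theorem coeff_numerTree_eq_zero (k : ℕ) : ∀ (x w : ℕ → F) (u : ℕ), 2 ^ k ≤ u →
    (numerTree k x w).coeff u = 0 := by
  induction k with
  | zero =>
    intro x w u hu
    rw [numerTree, Polynomial.coeff_C, if_neg (by simp at hu; omega)]
  | succ k ih =>
    intro x w u hu
    rw [pow_succ] at hu
    have key : ∀ x w y : ℕ → F, (numerTree k x w * denomTree k y).coeff u = 0 := fun x w y => by
      rw [Polynomial.coeff_mul]
      refine Finset.sum_eq_zero fun p hp => ?_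
      rw [Finset.HasAntidiagonal.mem_antidiagonal] at hp
      rcases le_or_gt (2 ^ k) p.1 with h | h
      · rw [ih x w _ h, zero_mul]
      · rw [Polynomial.coeff_eq_zero_of_natDegree_lt
          (lt_of_le_of_lt (natDegree_denomTree_le k y) (by omega)), mul_zero]
    rw [numerTree, Polynomial.coeff_add, key, key, add_zero]

/-- The denominators are constants, so each merge of two fractions is linear in the weights: two
Toeplitz products and one addition of vectors. -/
theorem reach_numerTree {μ K : ℕ} (hT : ∀ k < K, FastToeplitz F X μ k) (k : ℕ) (hk : k ≤ K) :
    ∀ (x : ℕ → F) (w : ℕ → X → F),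
      Reach (w '' {i | i < 2 ^ k})
        ((fun t v => (numerTree k x fun i => w i v).coeff t) '' {t | t < 2 ^ k})
        (k * 2 ^ k * (2 * μ + 3)) := by
  induction k with
  | zero =>
    intro x w
    refine (Reach.of_subset ?_).mono_ops (Nat.zero_le _)
    rintro _ ⟨t, ht, rfl⟩
    obtain rfl : t = 0 := by simpa using ht
    exact ⟨0, by simp, by simp [numerTree]⟩
  | succ k ih =>
    intro x w
    have h2 : 2 ^ (k + 1) = 2 * 2 ^ k := pow_succ' 2 k
    have half : ∀ (x : ℕ → F) (w : ℕ → X → F) (y : ℕ → F),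
        Reach (w '' {i | i < 2 ^ k})
          ((fun t v => (numerTree k x (fun i => w i v) * denomTree k y).coeff t) ''
            {t | t < 2 * 2 ^ k}) (k * 2 ^ k * (2 * μ + 3) + 2 * 1 * ((μ + 1) * 2 ^ k)) := by
      intro x w y
      have h3 := (hT k (by omega)).rect 2 1
        (fun n => if 0 ≤ n then (denomTree k y).coeff n.toNat else 0)
        (fun t v => (numerTree k x fun i => w i v).coeff t)
      rw [one_mul] at h3
      refine ((ih (by omega) x w).trans h3).mono_right (Set.image_congr' fun t => ?_).subset
      ext v
      rw [Polynomial.coeff_mul]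
      exact sum_antidiagonal_eq_toeplitz _ _ fun u hu _ => coeff_numerTree_eq_zero k _ _ u hu
    have h4 := (half x w (fun i => x (i + 2 ^ k))).mono_left
      (P' := w '' {i | i < 2 ^ (k + 1)}) (by
        refine Set.image_mono fun i hi => ?_
        simp only [Set.mem_ofPred_eq] at *
        omega)
    have h5 := (half (fun i => x (i + 2 ^ k)) (fun i => w (i + 2 ^ k)) x).mono_left
      (P' := w '' {i | i < 2 ^ (k + 1)}) (by
        rintro _ ⟨i, hi, rfl⟩
        refine ⟨i + 2 ^ k, ?_, rfl⟩
        simp only [Set.mem_ofPred_eq] at *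
        omega)
    refine ((h4.union h5).trans (Reach.of_forall (m := 2 * 2 ^ k) (n := 1)
      (Finset.range (2 * 2 ^ k))
      (fun t ht => Reach.add (Or.inl ⟨t, Finset.mem_range.1 ht, rfl⟩)
        (Or.inr ⟨t, Finset.mem_range.1 ht, rfl⟩)) ?_ (by simp))).mono_ops ?_
    · rintro _ ⟨t, ht, rfl⟩
      rw [Set.mem_ofPred_eq, h2] at ht
      refine Set.mem_biUnion (Finset.mem_coe.2 (Finset.mem_range.2 ht)) ?_
      rw [Set.mem_singleton_iff]
      ext v
      simp [numerTree]
    · rw [h2]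
      refine le_of_eq ?_
      ring

/-- The series `∑ x ^ t Z ^ t`. -/
noncomputable def geomSeries (x : F) : PowerSeries F := PowerSeries.mk fun t => x ^ t

theorem one_sub_mul_geomSeries (x : F) :
    (((1 - Polynomial.C x * Polynomial.X : Polynomial F)) : PowerSeries F) * geomSeries x = 1 := by
  ext t
  rw [Polynomial.coe_sub, Polynomial.coe_one, Polynomial.coe_mul, Polynomial.coe_C,
    Polynomial.coe_X, sub_mul, one_mul, map_sub, mul_assoc, PowerSeries.coeff_C_mul]
  cases t with
  | zero => simp [geomSeries]
  | succ t => simp [geomSeries, PowerSeries.coeff_succ_X_mul, pow_succ', PowerSeries.coeff_one]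

theorem coe_denomTree_mul (k : ℕ) (x : ℕ → F) :
    (denomTree k x : PowerSeries F) * ∏ i ∈ Finset.range (2 ^ k), geomSeries (x i) = 1 := by
  have : (denomTree k x : PowerSeries F) = ∏ i ∈ Finset.range (2 ^ k),
      ((1 - Polynomial.C (x i) * Polynomial.X : Polynomial F) : PowerSeries F) :=
    map_prod (Polynomial.coeToPowerSeries.ringHom (R := F))
      (fun i => 1 - Polynomial.C (x i) * Polynomial.X) (Finset.range (2 ^ k))
  rw [this, ← Finset.prod_mul_distrib]
  exact Finset.prod_eq_one fun i _ => one_sub_mul_geomSeries (x i)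

theorem sum_range_two_pow_succ {M : Type*} [AddCommMonoid M] (k : ℕ) (g : ℕ → M) :
    ∑ i ∈ Finset.range (2 ^ (k + 1)), g i =
      ∑ i ∈ Finset.range (2 ^ k), g i + ∑ i ∈ Finset.range (2 ^ k), g (i + 2 ^ k) := by
  rw [show 2 ^ (k + 1) = 2 ^ k + 2 ^ k by ring, Finset.sum_range_add]
  simp only [add_comm]

theorem prod_range_two_pow_succ {M : Type*} [CommMonoid M] (k : ℕ) (g : ℕ → M) :
    ∏ i ∈ Finset.range (2 ^ (k + 1)), g i =
      (∏ i ∈ Finset.range (2 ^ k), g i) * ∏ i ∈ Finset.range (2 ^ k), g (i + 2 ^ k) := by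
  rw [show 2 ^ (k + 1) = 2 ^ k + 2 ^ k by ring, Finset.prod_range_add]
  simp only [add_comm]

theorem coe_numerTree (k : ℕ) : ∀ (x w : ℕ → F), (numerTree k x w : PowerSeries F) =
    denomTree k x * ∑ i ∈ Finset.range (2 ^ k), PowerSeries.C (w i) * geomSeries (x i) := by
  induction k with
  | zero =>
    intro x w
    have := one_sub_mul_geomSeries (x 0)
    simp only [numerTree, denomTree, pow_zero, Finset.range_one, Finset.prod_singleton,
      Finset.sum_singleton, Polynomial.coe_C]
    rw [mul_left_comm, this, mul_one]
  | succ k ih =>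
    intro x w
    have hD : denomTree (k + 1) x = denomTree k x * denomTree k (fun i => x (i + 2 ^ k)) :=
      prod_range_two_pow_succ k _
    rw [numerTree, sum_range_two_pow_succ, hD]
    push_cast
    rw [ih, ih]
    ring

/-- The power sums are the coefficients of `∑ w i / (1 - x i Z)`, that is, of the numerator times
the constant series inverse to `denomTree`. -/
theorem reach_powerSums {μ K : ℕ} (hT : ∀ k < K, FastToeplitz F X μ k) (x : ℕ → F)
    (w : ℕ → X → F) :
    Reach (w '' {i | i < 2 ^ K})
      ((fun t v => ∑ i ∈ Finset.range (2 ^ K), w i v * x i ^ t) '' {t | t < 2 ^ K})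
      (K * 2 ^ K * (2 * μ + 3) + 2 * (μ + 1) * 2 ^ K) := by
  have h1 := reach_numerTree hT K le_rfl x w
  set S : PowerSeries F := ∏ i ∈ Finset.range (2 ^ K), geomSeries (x i) with hS
  have h2 : ∀ (t : ℕ) v, t < 2 ^ K → ∑ i ∈ Finset.range (2 ^ K), w i v * x i ^ t =
      ∑ u ∈ Finset.range (2 ^ K),
        (if (0 : ℤ) ≤ t - u then PowerSeries.coeff ((t : ℤ) - u).toNat S else 0) *
          (numerTree K x fun i => w i v).coeff u := fun t v ht => by
    rw [← sum_antidiagonal_eq_toeplitz (fun u => (numerTree K x fun i => w i v).coeff u)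
      (fun u => PowerSeries.coeff u S) (fun u hu _ => coeff_numerTree_eq_zero K _ _ u hu)]
    have h3 := PowerSeries.coeff_mul t ((numerTree K x fun i => w i v : Polynomial F) :
      PowerSeries F) S
    simp only [Polynomial.coeff_coe] at h3
    rw [← h3, coe_numerTree, mul_right_comm, hS, coe_denomTree_mul, one_mul, map_sum]
    exact Finset.sum_congr rfl fun i _ => by simp [PowerSeries.coeff_C_mul, geomSeries]
  have h3 : Reach ((fun t v => (numerTree K x fun i => w i v).coeff t) '' {t | t < 2 ^ K})
      ((fun t v => ∑ i ∈ Finset.range (2 ^ K), w i v * x i ^ t) '' {t | t < 2 ^ K})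
      (2 * (μ + 1) * 2 ^ K) := by
    cases K with
    | zero =>
      have h4 : Reach ((fun t v => (numerTree 0 x fun i => w i v).coeff t) '' {t | t < 2 ^ 0})
          {fun v => PowerSeries.coeff 0 S * (numerTree 0 x fun i => w i v).coeff 0} 1 := by
        refine Reach.const_mul (u := fun v => (numerTree 0 x fun i => w i v).coeff 0) ?_ _
        exact ⟨0, by simp, rfl⟩
      refine (h4.mono_right ?_).mono_ops (by omega)
      rintro _ ⟨t, ht, rfl⟩
      obtain rfl : t = 0 := by simpa using ht
      rw [Set.mem_singleton_iff]
      ext v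
      refine (h2 0 v (by simp)).trans ?_
      simp
    | succ k =>
      -- Splitting into four blocks of half size avoids Toeplitz products of size `2 ^ K`, which
      -- would need a root of unity of order `2 ^ (K + 1)`, more than `SupportsFFT` promises.
      have h4 := (hT k (Nat.lt_succ_self k)).rect 2 2
        (fun n => if 0 ≤ n then PowerSeries.coeff n.toNat S else 0)
        (fun t v => (numerTree (k + 1) x fun i => w i v).coeff t)
      rw [← pow_succ' 2 k] at h4
      refine (h4.mono_right ?_).mono_ops (le_of_eq (by ring))
      rintro _ ⟨t, ht, rfl⟩
      refine ⟨t, ht, ?_⟩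
      ext v
      exact (h2 t v ht).symm
  exact h1.trans h3

theorem sum_range_toeplitz_mul_pow {p : Polynomial F} {h t : ℕ} (hp : p.natDegree ≤ h)
    (ht : t < h) (x : F) :
    ∑ u ∈ Finset.range (2 * h), (if (t : ℤ) - u ≤ 0 then p.coeff (-((t : ℤ) - u)).toNat else 0) *
      x ^ u = x ^ t * p.eval x := by
  rw [Polynomial.eval_eq_sum_range' (show p.natDegree < 2 * h - t by omega),
    show 2 * h = t + (2 * h - t) by omega, Finset.sum_range_add, Finset.sum_eq_zero, zero_add,
    Nat.add_sub_cancel_left, Finset.mul_sum]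
  · refine Finset.sum_congr rfl fun u _ => ?_
    rw [if_pos (by omega), show (-((t : ℤ) - (t + u : ℕ))).toNat = u by omega, pow_add]
    ring
  · intro u hu
    rw [Finset.mem_range] at hu
    rw [if_neg (by omega), zero_mul]

/-- Descend a product tree: from weighted power sums to values of `∑ w i / q j`. -/
theorem reach_descend {μ K : ℕ} (hT : ∀ k < K, FastToeplitz F X μ k) (I : Finset ℕ) (x : ℕ → F)
    (w : ℕ → X → F) (k : ℕ) (hk : k ≤ K) :
    ∀ q : ℕ → Polynomial F, (∀ j, (q j).natDegree ≤ 1) → (∀ j, ∀ i ∈ I, (q j).eval (x i) ≠ 0) →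
      Reach ((fun t v => ∑ i ∈ I, w i v / (∏ j ∈ Finset.range (2 ^ k), q j).eval (x i) *
          x i ^ t) '' {t | t < 2 ^ k})
        ((fun j v => ∑ i ∈ I, w i v / (q j).eval (x i)) '' {j | j < 2 ^ k})
        (k * 2 ^ k * (2 * μ + 3)) := by
  induction k with
  | zero =>
    intro q _ _
    refine (Reach.of_subset ?_).mono_ops (Nat.zero_le _)
    rintro _ ⟨t, ht, rfl⟩
    obtain rfl : t = 0 := by simpa using ht
    exact ⟨0, by simp, by simp⟩
  | succ k ih =>
    intro q hq hx
    have h2 : 2 ^ (k + 1) = 2 * 2 ^ k := pow_succ' 2 k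
    set a : ℕ → X → F := fun t v =>
      ∑ i ∈ I, w i v / (∏ j ∈ Finset.range (2 ^ (k + 1)), q j).eval (x i) * x i ^ t with ha
    have half : ∀ q₁ q₂ : ℕ → Polynomial F, (∀ j, (q₁ j).natDegree ≤ 1) →
        (∀ j, (q₂ j).natDegree ≤ 1) → (∀ j, ∀ i ∈ I, (q₁ j).eval (x i) ≠ 0) →
        (∀ j, ∀ i ∈ I, (q₂ j).eval (x i) ≠ 0) →
        ∏ j ∈ Finset.range (2 ^ (k + 1)), q j =
          (∏ j ∈ Finset.range (2 ^ k), q₁ j) * ∏ j ∈ Finset.range (2 ^ k), q₂ j →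
        Reach (a '' {t | t < 2 ^ (k + 1)})
          ((fun j v => ∑ i ∈ I, w i v / (q₁ j).eval (x i)) '' {j | j < 2 ^ k})
          (1 * 2 * ((μ + 1) * 2 ^ k) + k * 2 ^ k * (2 * μ + 3)) := by
      intro q₁ q₂ hd₁ hd₂ hx₁ hx₂ hqq
      -- Multiplying the weights by the values of the sibling `m` cancels it from the denominators.
      -- On power sums this is a Toeplitz product, and since `m` has degree at most `2 ^ k`, the
      -- first `2 ^ k` new sums use only the `2 * 2 ^ k` known ones.
      set m := ∏ j ∈ Finset.range (2 ^ k), q₂ j with hm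
      have hmd : m.natDegree ≤ 2 ^ k :=
        (Polynomial.natDegree_prod_le _ _).trans
          ((Finset.sum_le_card_nsmul _ _ 1 fun j _ => hd₂ j).trans (by simp))
      have h3 := (hT k (by omega)).rect 1 2
        (fun n => if n ≤ 0 then m.coeff (-n).toNat else 0) a
      rw [h2]
      refine h3.trans ((ih (by omega) q₁ hd₁ hx₁).mono_left ?_)
      rintro _ ⟨t, ht, rfl⟩
      refine ⟨t, by simpa using ht, ?_⟩
      ext v
      simp only [ha, Finset.mul_sum]
      rw [Finset.sum_comm]
      refine Finset.sum_congr rfl fun i hi => ?_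
      have hne : m.eval (x i) ≠ 0 := by
        rw [hm, Polynomial.eval_prod]
        exact Finset.prod_ne_zero_iff.2 fun j _ => hx₂ j i hi
      have := sum_range_toeplitz_mul_pow hmd ht (x i)
      simp only [mul_left_comm _ (w i v / _)]
      rw [← Finset.mul_sum, this, hqq, Polynomial.eval_mul]
      field_simp
    have h4 := half q (fun j => q (j + 2 ^ k)) hq (fun j => hq _) hx (fun j => hx _)
      (prod_range_two_pow_succ k q)
    have h5 := half (fun j => q (j + 2 ^ k)) q (fun j => hq _) hq (fun j => hx _) hx
      (by rw [prod_range_two_pow_succ, mul_comm])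
    refine ((h4.union h5).mono_right ?_).mono_ops ?_
    · rintro _ ⟨j, hj, rfl⟩
      rw [Set.mem_ofPred_eq, h2] at hj
      rcases lt_or_ge j (2 ^ k) with h | h
      · exact Or.inl ⟨j, h, rfl⟩
      · refine Or.inr ⟨j - 2 ^ k, show j - 2 ^ k < 2 ^ k by omega, ?_⟩
        simp [Nat.sub_add_cancel h]
    · rw [h2]
      nlinarith [Nat.zero_le (2 ^ k)]

/-- Cauchy matrices through the fast multiplication of polynomials. -/
theorem reach_cauchy {I J : Type*} [Fintype I] [Fintype J] {μ K : ℕ}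
    (hT : ∀ k < K, FastToeplitz F X μ k) (hI : Fintype.card I ≤ 2 ^ K)
    (hJ : Fintype.card J ≤ 2 ^ K) (x : I → F) (y : J → F) (hxy : ∀ i j, x i ≠ y j)
    (u : I → X → F) :
    Reach (Set.range u) (Set.range fun j v => ∑ i, u i v / (x i - y j))
      (2 ^ K * ((K + 1) * (4 * μ + 6))) := by
  classical
  set n := Fintype.card I
  set m := Fintype.card J
  set eI := Fintype.equivFin I
  set eJ := Fintype.equivFin J
  set x' : ℕ → F := fun i => if h : i < n then x (eI.symm ⟨i, h⟩) else 0 with hx'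
  set u' : ℕ → X → F := fun i => if h : i < n then u (eI.symm ⟨i, h⟩) else fun _ => 0 with hu'
  -- Padding to a power of two: missing columns get the factor 1, and missing rows the weight 0.
  set q : ℕ → Polynomial F := fun j => if h : j < m then
    Polynomial.X - Polynomial.C (y (eJ.symm ⟨j, h⟩)) else 1 with hq
  have hqd : ∀ j, (q j).natDegree ≤ 1 := fun j => by
    by_cases h : j < m <;> simp [hq, h]
  have hqx : ∀ j, ∀ i ∈ Finset.range n, (q j).eval (x' i) ≠ 0 := fun j i hi => by
    rw [Finset.mem_range] at hi
    by_cases h : j < m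
    · simp [hq, h, hx', hi, sub_eq_zero, hxy]
    · simp [hq, h]
  set M := ∏ j ∈ Finset.range (2 ^ K), q j with hM
  set w : ℕ → X → F := fun i v => (M.eval (x' i))⁻¹ * u' i v with hw
  have h1 : Reach (Set.range u) (w '' {i | i < 2 ^ K}) (2 ^ K) := by
    refine Reach.of_forall (n := 1) (Finset.range (2 ^ K)) (Q := fun i => {w i})
      (fun i _ => ?_) ?_ (by simp)
    · refine Reach.drop_consts (Reach.const_mul ?_ _)
      by_cases h : i < n
      · exact Or.inl ⟨eI.symm ⟨i, h⟩, by simp [hu', h]⟩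
      · exact Or.inr ⟨0, by simp [hu', h]⟩
    · rintro _ ⟨i, hi, rfl⟩
      exact Set.mem_biUnion (Finset.mem_coe.2 (Finset.mem_range.2 hi)) rfl
  have h2 := reach_powerSums hT x' w
  have h3 := reach_descend hT (Finset.range n) x' u' K le_rfl q hqd hqx
  refine ((h1.trans h2).trans (h3.mono_left ?_) |>.mono_right ?_).mono_ops ?_
  · rintro _ ⟨t, ht, rfl⟩
    refine ⟨t, ht, ?_⟩
    ext v
    change ∑ i ∈ Finset.range (2 ^ K), w i v * x' i ^ t = _
    rw [← Finset.sum_subset (Finset.range_mono hI)]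
    · exact Finset.sum_congr rfl fun i _ => by simp only [hw, div_eq_inv_mul, hM]
    · intro i _ hi
      rw [Finset.mem_range] at hi
      simp [hw, hu', hi]
  · rintro _ ⟨j, rfl⟩
    refine ⟨eJ j, (eJ j).2.trans_le hJ, ?_⟩
    ext v
    change ∑ i ∈ Finset.range n, u' i v / (q (eJ j)).eval (x' i) = ∑ i, u i v / (x i - y j)
    rw [Finset.sum_range, ← eI.sum_comp]
    refine Finset.sum_congr rfl fun i _ => ?_
    have hj : (eJ j : ℕ) < m := (eJ j).2
    simp [hu', hq, hx', hj]
  · nlinarith [Nat.zero_le (2 ^ K * K), Nat.zero_le (2 ^ K * K * μ), Nat.zero_le (2 ^ K * μ)]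

end Trees

/-! ### Cost of Cauchy matrices in terms of `softLogSq` -/

section CauchyBound

theorem FastToeplitz.mono {F X : Type*} [Field F] {μ ν k : ℕ} (h : FastToeplitz F X μ k)
    (hμ : μ ≤ ν) : FastToeplitz F X ν k :=
  fun s a => (h s a).mono_ops (Nat.mul_le_mul_right _ hμ)

theorem one_le_lg {x : ℝ} (hx : 1 ≤ x) : 1 ≤ lg x := by
  rw [lg, Real.le_logb_iff_rpow_le one_lt_two (by linarith)]
  norm_num
  linarith

theorem two_pow_clog_le {b : ℕ} (hb : 1 ≤ b) : 2 ^ Nat.clog 2 b ≤ 2 * b := by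
  rcases Nat.eq_or_lt_of_le hb with rfl | hb
  · simp
  · have h0 : 0 < Nat.clog 2 b := Nat.clog_pos one_lt_two hb
    have := Nat.pow_pred_clog_lt_self one_lt_two hb
    calc 2 ^ Nat.clog 2 b = 2 * 2 ^ (Nat.clog 2 b - 1) := by
          rw [← pow_succ', Nat.sub_add_cancel h0]
      _ ≤ 2 * b := Nat.mul_le_mul_left 2 this.le

theorem clog_le_one_add_lg {b : ℕ} (hb : 1 ≤ b) : (Nat.clog 2 b : ℝ) ≤ 1 + lg b := by
  have h1 : ((2 : ℝ)) ^ Nat.clog 2 b ≤ 2 * (b + 1) := by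
    have : ((2 ^ Nat.clog 2 b : ℕ) : ℝ) ≤ ((2 * b : ℕ) : ℝ) := by
      exact_mod_cast two_pow_clog_le hb
    push_cast at this
    linarith
  have h2 := Real.logb_le_logb_of_le one_lt_two (by positivity) h1
  rw [Real.logb_pow, Real.logb_mul (by norm_num) (by positivity), Real.logb_self_eq_one one_lt_two,
    mul_one] at h2
  exact h2

theorem natLog_add_one_le_lg {K : ℕ} {x : ℝ} (hx : 1 ≤ x) (hK : (K : ℝ) ≤ 1 + x) :
    (Nat.log 2 K : ℝ) + 1 ≤ 2 * lg x := by
  have h1 := one_le_lg hx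
  have h2 : (Nat.log 2 K : ℝ) ≤ lg x := by
    rcases Nat.eq_zero_or_pos K with rfl | h
    · simp
      linarith
    · have h3 : ((2 : ℝ)) ^ Nat.log 2 K ≤ x + 1 := by
        have : ((2 ^ Nat.log 2 K : ℕ) : ℝ) ≤ (K : ℝ) := by
          exact_mod_cast Nat.pow_log_le_self 2 h.ne'
        push_cast at this
        linarith
      have h4 := Real.logb_le_logb_of_le one_lt_two (by positivity) h3
      rwa [Real.logb_pow, Real.logb_self_eq_one one_lt_two, mul_one] at h4
  linarith

theorem one_le_softLogSq (F : Type*) [Field F] {b : ℕ} (hb : 1 ≤ b) : 1 ≤ softLogSq F b := by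
  have h1 : 1 ≤ lg b := one_le_lg (by exact_mod_cast hb)
  have h2 := one_le_lg h1
  rw [softLogSq]
  split_ifs
  · nlinarith
  · nlinarith

/-- Cauchy matrices with at most `b` rows and columns, in softly linear time. -/
theorem exists_reach_cauchy (F : Type u) [Field F] (X : Type*) {b : ℕ} (hb : 1 ≤ b) :
    ∃ N : ℕ, (N : ℝ) ≤ 3000000 * (b * softLogSq F b) ∧
      ∀ {I J : Type} [Fintype I] [Fintype J], Fintype.card I ≤ b → Fintype.card J ≤ b →
        ∀ (x : I → F) (y : J → F), (∀ i j, x i ≠ y j) → ∀ u : I → X → F,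
          Reach (Set.range u) (Set.range fun j v => ∑ i, u i v / (x i - y j)) N := by
  set K := Nat.clog 2 b with hK
  have hbK : b ≤ 2 ^ K := Nat.le_pow_clog one_lt_two b
  have h1 : 1 ≤ lg b := one_le_lg (by exact_mod_cast hb)
  have h2 := one_le_lg h1
  have hK1 : (K : ℝ) ≤ 1 + lg b := clog_le_one_add_lg hb
  have hK2 : ((K : ℝ) + 1) ^ 2 ≤ 9 * lg b ^ 2 := by
    have : (K : ℝ) + 1 ≤ 3 * lg b := by linarith
    calc ((K : ℝ) + 1) ^ 2 ≤ (3 * lg b) ^ 2 := by gcongr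
      _ = _ := by ring
  have hpow : ((2 : ℝ)) ^ K ≤ 2 * b := by exact_mod_cast two_pow_clog_le hb
  have hb0 : (0 : ℝ) ≤ b := Nat.cast_nonneg b
  have finish : ∀ μ : ℕ, (∀ k < K, FastToeplitz F X μ k) →
      ((K : ℝ) + 1) * (4 * μ + 6) ≤ 1500000 * softLogSq F b →
      ∃ N : ℕ, (N : ℝ) ≤ 3000000 * (b * softLogSq F b) ∧
      ∀ {I J : Type} [Fintype I] [Fintype J], Fintype.card I ≤ b → Fintype.card J ≤ b →
        ∀ (x : I → F) (y : J → F), (∀ i j, x i ≠ y j) → ∀ u : I → X → F,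
          Reach (Set.range u) (Set.range fun j v => ∑ i, u i v / (x i - y j)) N := by
    intro μ hμ hle
    refine ⟨2 ^ K * ((K + 1) * (4 * μ + 6)), ?_, fun hI hJ x y hxy u =>
      reach_cauchy hμ (hI.trans hbK) (hJ.trans hbK) x y hxy u⟩
    push_cast
    calc (2 : ℝ) ^ K * ((K + 1) * (4 * μ + 6)) ≤ 2 * b * (1500000 * softLogSq F b) := by gcongr
      _ = _ := by ring
  by_cases hF : SupportsFFT F b
  · obtain ⟨k', ω, hk', hω⟩ := id hF
    have hKk : K ≤ k' := Nat.clog_le_of_le_pow hk'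
    refine finish (18 * (K + 1)) (fun k hk => ?_) ?_
    -- Only sizes `k < K` occur, so roots of order at most `2 ^ K ≤ 2 ^ k'` suffice.
    · have hω' : IsPrimitiveRoot (ω ^ 2 ^ (k' - (k + 1))) (2 ^ (k + 1)) :=
        hω.pow (by positivity) (by rw [← pow_add, Nat.sub_add_cancel (by omega)])
      exact (fastToeplitz_of_isPrimitiveRoot X hω').mono (by omega)
    · rw [softLogSq, if_pos hF]
      push_cast
      nlinarith [Nat.cast_nonneg (α := ℝ) K]
  · refine finish (18 * (36 + 936 * (K * (Nat.log 2 K + 1))))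
      (fun k hk => (fastToeplitz F X k).mono ?_) ?_
    · gcongr
    · rw [softLogSq, if_neg hF]
      have h3 := natLog_add_one_le_lg h1 hK1
      push_cast
      set L : ℝ := (Nat.log 2 K : ℝ) + 1 with hL
      have hL1 : 1 ≤ L := by simp [hL]
      have hK0 : (0 : ℝ) ≤ K := Nat.cast_nonneg K
      calc ((K : ℝ) + 1) * (4 * (18 * (36 + 936 * (K * L))) + 6)
          ≤ ((K : ℝ) + 1) * (69990 * ((K + 1) * L)) := by
            gcongr
            nlinarith
        _ = 69990 * (((K : ℝ) + 1) ^ 2 * L) := by ring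
        _ ≤ 69990 * ((9 * lg b ^ 2) * (2 * lg (lg b))) := by gcongr
        _ ≤ 1500000 * (lg b ^ 2 * lg (lg b)) := by
            have : 0 ≤ lg b ^ 2 * lg (lg b) := by positivity
            nlinarith

end CauchyBound

/-! ### Lagrange interpolation and interference alignment -/

section Interpolation

variable {F : Type*} [Field F]

/-- Lagrange interpolation written as a Cauchy sum. It serves twice: at the `f l k` to choose inputs
with prescribed shares, and at the `α s` to invert the Cauchy–Vandermonde system. -/
theorem eval_eq_prod_mul_sum {ι : Type*} [Fintype ι] [DecidableEq ι] {v : ι → F}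
    (hv : Function.Injective v) {p : Polynomial F} (hp : p.degree < Fintype.card ι) {x : F}
    (hx : ∀ i, v i ≠ x) :
    p.eval x = (∏ i, (v i - x)) *
      ∑ i, p.eval (v i) / (∏ i' ∈ Finset.univ.erase i, (v i' - v i)) / (v i - x) := by
  have h := Lagrange.eq_interpolate (s := Finset.univ) hv.injOn (by simpa using hp)
  conv_lhs => rw [h, Lagrange.interpolate_apply, Polynomial.eval_finsetSum]
  rw [Finset.mul_sum]
  refine Finset.sum_congr rfl fun i _ => ?_
  rw [Polynomial.eval_mul, Polynomial.eval_C, Lagrange.basis, Polynomial.eval_prod,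
    ← Finset.mul_prod_erase _ _ (Finset.mem_univ i)]
  have h1 : ∏ j ∈ Finset.univ.erase i, Polynomial.eval x (Lagrange.basisDivisor (v i) (v j)) =
      (∏ j ∈ Finset.univ.erase i, (v j - x)) / ∏ j ∈ Finset.univ.erase i, (v j - v i) := by
    rw [← Finset.prod_div_distrib]
    refine Finset.prod_congr rfl fun j hj => ?_
    have hne : v i - v j ≠ 0 := sub_ne_zero.2 fun h => (Finset.ne_of_mem_erase hj) (hv h).symm
    have hne' : v j - v i ≠ 0 := sub_ne_zero.2 fun h => (Finset.ne_of_mem_erase hj) (hv h)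
    simp only [Lagrange.basisDivisor, Polynomial.eval_mul, Polynomial.eval_C, Polynomial.eval_sub,
      Polynomial.eval_X]
    rw [eq_div_iff hne', ← neg_sub (v i) (v j)]
    field_simp
    ring
  have hxi : v i - x ≠ 0 := sub_ne_zero.2 (hx i)
  rw [h1]
  field_simp

theorem prod_erase_sub_ne_zero {ι : Type*} [Fintype ι] [DecidableEq ι] {v : ι → F}
    (hv : Function.Injective v) (i : ι) : ∏ i' ∈ Finset.univ.erase i, (v i' - v i) ≠ 0 :=
  Finset.prod_ne_zero_iff.2 fun _ hj =>
    sub_ne_zero.2 fun h => (Finset.ne_of_mem_erase hj) (hv h)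

theorem eval_eq_sum_fin {n : ℕ} {p : Polynomial F} (hp : p.degree < n) (x : F) :
    p.eval x = ∑ i : Fin n, p.coeff i * x ^ (i : ℕ) := by
  rw [Polynomial.eval_eq_sum, ← Polynomial.sum_fin (fun i a => a * x ^ i) (by simp) hp]

open Polynomial in
theorem degree_prod_C_sub_X_le {ι : Type*} (s : Finset ι) (v : ι → F) :
    (∏ i ∈ s, (C (v i) - X)).degree ≤ (s.card : WithBot ℕ) := by
  refine (Polynomial.degree_prod_le _ _).trans ?_
  refine (Finset.sum_le_card_nsmul _ _ 1 fun i _ => ?_).trans (by simp)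
  rw [← neg_sub, Polynomial.degree_neg]
  exact Polynomial.degree_X_sub_C_le _

/-- Interference aligns: only the products with equal indices have a pole. -/
theorem exists_aligned {n : ℕ} (v : Fin n → F) (k k' : Fin n) :
    ∃ g : Fin (n - 1) → F, ∀ x, (∀ i, v i ≠ x) →
      (∏ i, (v i - x)) * ((1 / (v k - x)) * (1 / (v k' - x))) =
        (if k = k' then (∏ i ∈ Finset.univ.erase k, (v i - v k)) * (1 / (v k - x)) else 0) +
          ∑ i, g i * x ^ (i : ℕ) := by
  have hn : 0 < n := Fin.pos k
  suffices h : ∃ G : Polynomial F, G.degree < (n - 1 : ℕ) ∧ ∀ x, (∀ i, v i ≠ x) →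
      (∏ i, (v i - x)) * ((1 / (v k - x)) * (1 / (v k' - x))) =
        (if k = k' then (∏ i ∈ Finset.univ.erase k, (v i - v k)) * (1 / (v k - x)) else 0) +
          G.eval x by
    obtain ⟨G, hG, h⟩ := h
    exact ⟨fun i => G.coeff i, fun x hx => by rw [h x hx, eval_eq_sum_fin hG]⟩
  by_cases hk : k = k'
  · subst hk
    set H : Polynomial F := ∏ i ∈ Finset.univ.erase k, (Polynomial.C (v i) - Polynomial.X) with hH
    have hH0 : H ≠ 0 := Finset.prod_ne_zero_iff.2 fun i _ => by
      rw [← neg_sub]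
      exact neg_ne_zero.2 (Polynomial.X_sub_C_ne_zero _)
    have hHd : H.degree ≤ (n - 1 : ℕ) := by
      simpa using degree_prod_C_sub_X_le (Finset.univ.erase k) v
    have hHe : ∀ x, H.eval x = ∏ i ∈ Finset.univ.erase k, (v i - x) := fun x => by
      simp [hH, Polynomial.eval_prod]
    -- Division with remainder, `H = H(v k) + (X - v k) * quotient`, splits `H / (v k - x)` into its
    -- pole and minus the quotient.
    refine ⟨-(H /ₘ (Polynomial.X - Polynomial.C (v k))), ?_, fun x hx => ?_⟩
    · rw [Polynomial.degree_neg]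
      exact (Polynomial.degree_divByMonic_lt _ _ hH0
        (by rw [Polynomial.degree_X_sub_C]; exact zero_lt_one)).trans_le hHd
    · have hdiv := congrArg (Polynomial.eval x)
        (Polynomial.modByMonic_add_div H (Polynomial.X - Polynomial.C (v k)))
      rw [Polynomial.modByMonic_X_sub_C_eq_C_eval] at hdiv
      simp only [Polynomial.eval_add, Polynomial.eval_C, Polynomial.eval_mul, Polynomial.eval_sub,
        Polynomial.eval_X] at hdiv
      have hxk : v k - x ≠ 0 := sub_ne_zero.2 (hx k)
      rw [if_pos rfl, ← Finset.mul_prod_erase _ _ (Finset.mem_univ k), ← hHe, ← hHe, ← hdiv,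
        Polynomial.eval_neg]
      field_simp
      ring
  · have hk' : k' ∈ Finset.univ.erase k := Finset.mem_erase.2 ⟨Ne.symm hk, Finset.mem_univ _⟩
    refine ⟨∏ i ∈ (Finset.univ.erase k).erase k', (Polynomial.C (v i) - Polynomial.X), ?_,
      fun x hx => ?_⟩
    · refine (degree_prod_C_sub_X_le _ v).trans_lt ?_
      rw [Finset.card_erase_of_mem hk', Finset.card_erase_of_mem (Finset.mem_univ k),
        Finset.card_univ, Fintype.card_fin]
      have : 1 < n := by
        have := k.2; have := k'.2
        have : (k : ℕ) ≠ k' := fun h => hk (Fin.ext h)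
        omega
      exact_mod_cast (show n - 1 - 1 < n - 1 by omega)
    · have hxk : v k - x ≠ 0 := sub_ne_zero.2 (hx k)
      have hxk' : v k' - x ≠ 0 := sub_ne_zero.2 (hx k')
      rw [if_neg hk, ← Finset.mul_prod_erase _ _ (Finset.mem_univ k),
        ← Finset.mul_prod_erase _ _ hk', zero_add, Polynomial.eval_prod]
      simp only [Polynomial.eval_sub, Polynomial.eval_C, Polynomial.eval_X]
      field_simp

end Interpolation

/-! ### Distinct evaluation points -/

section Distinct

variable {F : Type*} {S ℓ Kc : ℕ} {f : Fin ℓ → Fin Kc → F} {α : Fin S → F}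

/-- The evaluation points are distinct. -/
def Distinct (f : Fin ℓ → Fin Kc → F) (α : Fin S → F) : Prop :=
  Function.Injective (Sum.elim (fun p : Fin ℓ × Fin Kc => f p.1 p.2) α)

theorem Distinct.ne (h : Distinct f α) (l : Fin ℓ) (k : Fin Kc) (s : Fin S) : f l k ≠ α s :=
  fun e => by simpa using @h (Sum.inl (l, k)) (Sum.inr s) e

theorem Distinct.injective_left (h : Distinct f α) :
    Function.Injective fun p : Fin ℓ × Fin Kc => f p.1 p.2 :=
  fun p q e => by simpa using @h (Sum.inl p) (Sum.inl q) e

theorem Distinct.injective_block (h : Distinct f α) (l : Fin ℓ) : Function.Injective (f l) :=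
  fun k k' e => by simpa using @h (Sum.inl (l, k)) (Sum.inl (l, k')) e

theorem Distinct.injective_right (h : Distinct f α) : Function.Injective α :=
  fun s s' e => by simpa using @h (Sum.inr s) (Sum.inr s') e

end Distinct

/-! ### Inverting the Cauchy–Vandermonde matrix -/

section Decoding

variable {F : Type*} [Field F] {S ℓ Kc : ℕ} {f : Fin ℓ → Fin Kc → F} {α : Fin S → F}

/-- The rows of the inverse of the Cauchy–Vandermonde matrix that yield the desired products. -/
noncomputable def decodingRow (f : Fin ℓ → Fin Kc → F) (α : Fin S → F) (T : Finset (Fin S))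
    (p : Fin ℓ × Fin Kc) (s : T) : F :=
  ((∏ s' : T, (α s' - f p.1 p.2)) /
      ∏ p' ∈ Finset.univ.erase p, (f p'.1 p'.2 - f p.1 p.2)) *
    ((∏ p' : Fin ℓ × Fin Kc, (f p'.1 p'.2 - α s)) /
      ∏ s' ∈ Finset.univ.erase s, (α s' - α s)) / (α s - f p.1 p.2)

theorem Distinct.residueCoeff_ne_zero (h : Distinct f α) (l : Fin ℓ) (k : Fin Kc) :
    residueCoeff f l k ≠ 0 :=
  prod_erase_sub_ne_zero (h.injective_block l) k

variable {T : Finset (Fin S)}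

theorem decodingRow_ne_zero (h : Distinct f α) (p : Fin ℓ × Fin Kc) (s : T) :
    decodingRow f α T p s ≠ 0 := by
  have h1 := prod_erase_sub_ne_zero h.injective_left p
  have h2 := prod_erase_sub_ne_zero (h.injective_right.comp (Subtype.val_injective (p := (· ∈ T)))) s
  refine div_ne_zero (mul_ne_zero (div_ne_zero ?_ h1) (div_ne_zero ?_ h2)) ?_
  · exact Finset.prod_ne_zero_iff.2 fun s' _ => sub_ne_zero.2 (h.ne _ _ _).symm
  · exact Finset.prod_ne_zero_iff.2 fun p' _ => sub_ne_zero.2 (h.ne _ _ _)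
  · exact sub_ne_zero.2 (h.ne _ _ _).symm

/-- Over the common denominator `∏ (f - α_s)`, every combination of columns is given by a polynomial
of degree below `R`. Interpolating it from the `α s` to `f p` and dividing by the other factors
reads off the coefficient of the pole at `f p`. -/
theorem sum_decodingRow_mul (h : Distinct f α) {P : Polynomial F} (hP : P.degree < T.card)
    (p : Fin ℓ × Fin Kc) :
    ∑ s : T, decodingRow f α T p s * (P.eval (α s) / ∏ p' : Fin ℓ × Fin Kc, (f p'.1 p'.2 - α s)) =
      P.eval (f p.1 p.2) / ∏ p' ∈ Finset.univ.erase p, (f p'.1 p'.2 - f p.1 p.2) := by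
  have key := eval_eq_prod_mul_sum (v := fun s : T => α s)
    (h.injective_right.comp Subtype.val_injective) (p := P) (by simpa using hP)
    (x := f p.1 p.2) (fun s => (h.ne _ _ _).symm)
  rw [key, Finset.mul_sum, Finset.sum_div]
  refine Finset.sum_congr rfl fun s _ => ?_
  have h0 : ∏ p' : Fin ℓ × Fin Kc, (f p'.1 p'.2 - α s) ≠ 0 :=
    Finset.prod_ne_zero_iff.2 fun p' _ => sub_ne_zero.2 (h.ne _ _ _)
  rw [decodingRow]
  field_simp

theorem decodingRow_mul_cauchyVandermonde (h : Distinct f α) (hℓ : 0 < ℓ) (hKc : 0 < Kc)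
    (hT : T.card = (ℓ + 1) * Kc - 1) (p : Fin ℓ × Fin Kc)
    (c : (Fin ℓ × Fin Kc) ⊕ Fin (Kc - 1)) :
    ∑ s : T, decodingRow f α T p s * cauchyVandermonde f α T s c =
      if c = Sum.inl p then 1 else 0 := by
  have hcard : T.card = ℓ * Kc + (Kc - 1) := by
    rw [hT, add_mul, one_mul, Nat.add_sub_assoc hKc]
  have hL : 0 < ℓ * Kc := Nat.mul_pos hℓ hKc
  have h0 : ∀ s : T, ∏ p' : Fin ℓ × Fin Kc, (f p'.1 p'.2 - α s) ≠ 0 := fun s =>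
    Finset.prod_ne_zero_iff.2 fun p' _ => sub_ne_zero.2 (h.ne _ _ _)
  have hp0 := prod_erase_sub_ne_zero h.injective_left p
  rcases c with q | i
  · set P : Polynomial F := ∏ p' ∈ Finset.univ.erase q,
      (Polynomial.C (f p'.1 p'.2) - Polynomial.X) with hP
    have hPe : ∀ x, P.eval x = ∏ p' ∈ Finset.univ.erase q, (f p'.1 p'.2 - x) := fun x => by
      simp [hP, Polynomial.eval_prod]
    have hPd : P.degree < T.card := by
      refine (degree_prod_C_sub_X_le _ (fun p' : Fin ℓ × Fin Kc => f p'.1 p'.2)).trans_lt ?_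
      rw [Finset.card_erase_of_mem (Finset.mem_univ _), Finset.card_univ, Fintype.card_prod,
        Fintype.card_fin, Fintype.card_fin]
      exact_mod_cast (show ℓ * Kc - 1 < T.card by omega)
    have key := sum_decodingRow_mul h hPd p
    convert key using 1
    · refine Finset.sum_congr rfl fun s _ => ?_
      congr 1
      have hq : f q.1 q.2 - α s ≠ 0 := sub_ne_zero.2 (h.ne _ _ _)
      have h1 := h0 s
      rw [← Finset.mul_prod_erase _ _ (Finset.mem_univ q)] at h1 ⊢
      rw [hPe]
      simp only [cauchyVandermonde, Matrix.of_apply, Sum.elim_inl]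
      rw [div_mul_eq_div_div_swap, div_self (right_ne_zero_of_mul h1)]
    · rw [hPe]
      by_cases hqp : q = p
      · subst hqp
        rw [if_pos rfl, div_self hp0]
      · rw [if_neg (by simpa using hqp), Finset.prod_eq_zero
          (Finset.mem_erase.2 ⟨Ne.symm hqp, Finset.mem_univ p⟩) (sub_self _), zero_div]
  · set P : Polynomial F := (∏ p' : Fin ℓ × Fin Kc,
      (Polynomial.C (f p'.1 p'.2) - Polynomial.X)) * Polynomial.X ^ (i : ℕ) with hP
    have hPd : P.degree < T.card := by
      rw [hP, Polynomial.degree_mul, Polynomial.degree_X_pow]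
      have h1 := degree_prod_C_sub_X_le Finset.univ (fun p' : Fin ℓ × Fin Kc => f p'.1 p'.2)
      rw [Finset.card_univ, Fintype.card_prod, Fintype.card_fin, Fintype.card_fin] at h1
      refine (add_le_add_left h1 _).trans_lt ?_
      exact_mod_cast (show ℓ * Kc + (i : ℕ) < T.card by omega)
    have key := sum_decodingRow_mul h hPd p
    convert key using 1
    · refine Finset.sum_congr rfl fun s _ => ?_
      congr 1
      rw [hP, Polynomial.eval_mul, Polynomial.eval_prod]
      simp only [Polynomial.eval_sub, Polynomial.eval_C, Polynomial.eval_X, Polynomial.eval_pow]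
      rw [mul_div_cancel_left₀ _ (h0 s)]
      rfl
    · rw [if_neg (by simp), hP, Polynomial.eval_mul, Polynomial.eval_prod,
        Finset.prod_eq_zero (Finset.mem_univ p) (by simp), zero_mul, zero_div]

theorem decodingMatrix_mul (h : Distinct f α) (hℓ : 0 < ℓ) (hKc : 0 < Kc)
    (hT : T.card = (ℓ + 1) * Kc - 1) :
    decodingMatrix f α T * cauchyVandermonde f α T = 1 := by
  have hcard : T.card = ℓ * Kc + (Kc - 1) := by
    rw [hT, add_mul, one_mul, Nat.add_sub_assoc hKc]
  have hex : ∃ W : Matrix ((Fin ℓ × Fin Kc) ⊕ Fin (Kc - 1)) T F,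
      W * cauchyVandermonde f α T = 1 := by
    -- A kernel vector has no Cauchy part, by `decodingRow`; what remains is a polynomial of degree
    -- below `Kc - 1` with `R` zeros.
    have hker : LinearMap.ker (cauchyVandermonde f α T).mulVecLin = ⊥ := by
      rw [LinearMap.ker_eq_bot']
      intro w hw
      have hw' : ∀ s, ∑ c, cauchyVandermonde f α T s c * w c = 0 := fun s => congrFun hw s
      have hl : ∀ p, w (Sum.inl p) = 0 := fun p => by
        have h1 : ∑ s : T, decodingRow f α T p s * ∑ c, cauchyVandermonde f α T s c * w c = 0 := by
          simp [hw']
        simp only [Finset.mul_sum, ← mul_assoc] at h1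
        rw [Finset.sum_comm] at h1
        simp only [← Finset.sum_mul, decodingRow_mul_cauchyVandermonde h hℓ hKc hT] at h1
        simpa using h1
      set E : Polynomial F := ∑ i : Fin (Kc - 1),
        Polynomial.C (w (Sum.inr i)) * Polynomial.X ^ (i : ℕ) with hE
      have hE0 : E = 0 := by
        refine Polynomial.eq_zero_of_degree_lt_of_eval_index_eq_zero (s := T)
          (v := α) h.injective_right.injOn ?_ fun s hs => ?_
        · refine (Polynomial.degree_sum_fin_lt _).trans_le ?_
          exact_mod_cast (show Kc - 1 ≤ T.card by omega)
        · have := hw' ⟨s, hs⟩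
          rw [Fintype.sum_sum_type] at this
          simp only [hl, mul_zero, Finset.sum_const_zero, zero_add] at this
          rw [hE, Polynomial.eval_finsetSum, ← this]
          refine Finset.sum_congr rfl fun i _ => ?_
          simp only [Polynomial.eval_mul, Polynomial.eval_C, Polynomial.eval_pow,
            Polynomial.eval_X, cauchyVandermonde, Matrix.of_apply, Sum.elim_inr]
          exact mul_comm _ _
      ext c
      rcases c with p | i
      · exact hl p
      · have hi : E.coeff i = 0 := by rw [hE0, Polynomial.coeff_zero]
        rw [hE, Polynomial.finsetSum_coeff, Finset.sum_eq_single i] at hi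
        · simpa using hi
        · intro j _ hj
          rw [Polynomial.coeff_C_mul, Polynomial.coeff_X_pow,
            if_neg (fun h => hj (Fin.ext h.symm)), mul_zero]
        · simp
    obtain ⟨g, hg⟩ := LinearMap.exists_leftInverse_of_injective _ hker
    refine ⟨LinearMap.toMatrix' g, ?_⟩
    have := congrArg LinearMap.toMatrix' hg
    rwa [LinearMap.toMatrix'_comp, ← Matrix.toLin'_apply', LinearMap.toMatrix'_toLin',
      LinearMap.toMatrix'_id] at this
  rw [decodingMatrix, dif_pos hex]
  exact hex.choose_spec

theorem cauchyVandermonde_mul (h : Distinct f α) (hℓ : 0 < ℓ) (hKc : 0 < Kc)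
    (hT : T.card = (ℓ + 1) * Kc - 1) :
    cauchyVandermonde f α T * decodingMatrix f α T = 1 := by
  have hcard : T.card = ℓ * Kc + (Kc - 1) := by
    rw [hT, add_mul, one_mul, Nat.add_sub_assoc hKc]
  exact (Matrix.mul_eq_one_comm_of_card_eq _ _ _ (by simp [hcard])).1 (decodingMatrix_mul h hℓ hKc hT)

theorem decodingMatrix_inl (h : Distinct f α) (hℓ : 0 < ℓ) (hKc : 0 < Kc)
    (hT : T.card = (ℓ + 1) * Kc - 1) (p : Fin ℓ × Fin Kc) (s : T) :
    decodingMatrix f α T (Sum.inl p) s = decodingRow f α T p s := by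
  have h1 : (Matrix.of (decodingRow f α T) * cauchyVandermonde f α T) *
      decodingMatrix f α T = Matrix.of (decodingRow f α T) := by
    rw [Matrix.mul_assoc, cauchyVandermonde_mul h hℓ hKc hT, Matrix.mul_one]
  have h2 := congrFun (congrFun h1 p) s
  rw [Matrix.mul_apply] at h2
  simp only [Matrix.mul_apply, Matrix.of_apply,
    decodingRow_mul_cauchyVandermonde h hℓ hKc hT] at h2
  simpa using h2

end Decoding

/-! ### Recovery threshold -/

section Recovery

variable {F : Type*} [Field F] {S ℓ Kc lam kap mu : ℕ} {f : Fin ℓ → Fin Kc → F} {α : Fin S → F}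
  {T : Finset (Fin S)}

theorem answers_apply (A : Fin (ℓ * Kc) → Matrix (Fin lam) (Fin kap) F)
    (B : Fin (ℓ * Kc) → Matrix (Fin kap) (Fin mu) F) (s : T) (i : Fin lam) (j : Fin mu) :
    (csaCode f α lam kap mu).answers T A B s (i, j) =
      ∑ l, (shareA f α s A l * shareB f α s B l) i j := rfl

theorem shareA_mul_shareB (s : Fin S) (A : Fin (ℓ * Kc) → Matrix (Fin lam) (Fin kap) F)
    (B : Fin (ℓ * Kc) → Matrix (Fin kap) (Fin mu) F) (l : Fin ℓ) (i : Fin lam) (j : Fin mu) :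
    (shareA f α s A l * shareB f α s B l) i j =
      ∑ k, ∑ k', Delta f α l s * ((1 / (f l k - α s)) * (1 / (f l k' - α s))) *
        (A (finProdFinEquiv (l, k)) * B (finProdFinEquiv (l, k'))) i j := by
  rw [shareA, shareB, Matrix.smul_mul, Matrix.sum_mul, Matrix.smul_apply, Matrix.sum_apply,
    smul_eq_mul, Finset.mul_sum]
  refine Finset.sum_congr rfl fun k _ => ?_
  rw [Matrix.mul_sum, Matrix.sum_apply, Finset.mul_sum]
  refine Finset.sum_congr rfl fun k' _ => ?_
  rw [Matrix.smul_mul, Matrix.mul_smul, Matrix.smul_apply, Matrix.smul_apply]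
  simp only [smul_eq_mul]
  ring

/-- The answers are the product of the Cauchy–Vandermonde matrix with a vector of scaled desired
products and of aligned interference. -/
theorem exists_answers_eq (h : Distinct f α) (A : Fin (ℓ * Kc) → Matrix (Fin lam) (Fin kap) F)
    (B : Fin (ℓ * Kc) → Matrix (Fin kap) (Fin mu) F) (T : Finset (Fin S)) (i : Fin lam)
    (j : Fin mu) :
    ∃ e : Fin (Kc - 1) → F, ∀ s : T, (csaCode f α lam kap mu).answers T A B s (i, j) =
      ∑ c, cauchyVandermonde f α T s c * Sum.elim (fun p : Fin ℓ × Fin Kc =>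
        residueCoeff f p.1 p.2 * (A (finProdFinEquiv p) * B (finProdFinEquiv p)) i j) e c := by
  choose g hg using fun l k k' => exists_aligned (f l) k k'
  refine ⟨fun t => ∑ l, ∑ k, ∑ k', g l k k' t *
    (A (finProdFinEquiv (l, k)) * B (finProdFinEquiv (l, k'))) i j, fun s => ?_⟩
  rw [answers_apply, Fintype.sum_sum_type, Fintype.sum_prod_type]
  have hl : ∀ l, (shareA f α s A l * shareB f α s B l) i j =
      ∑ k, (1 / (f l k - α s)) * (residueCoeff f l k *
        (A (finProdFinEquiv (l, k)) * B (finProdFinEquiv (l, k))) i j) +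
      ∑ t : Fin (Kc - 1), α s ^ (t : ℕ) * ∑ k, ∑ k', g l k k' t *
        (A (finProdFinEquiv (l, k)) * B (finProdFinEquiv (l, k'))) i j := by
    intro l
    rw [shareA_mul_shareB]
    simp only [Delta, hg l _ _ (α s) (fun k => h.ne l k s), add_mul, Finset.sum_add_distrib]
    congr 1
    · refine Finset.sum_congr rfl fun k _ => ?_
      rw [Finset.sum_eq_single k]
      · rw [if_pos rfl, residueCoeff]
        ring
      · intro k' _ hk'
        rw [if_neg hk'.symm, zero_mul]
      · simp
    · simp only [Finset.mul_sum, Finset.sum_mul]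
      conv_rhs => rw [Finset.sum_comm]
      refine Finset.sum_congr rfl fun k _ => ?_
      rw [Finset.sum_comm]
      refine Finset.sum_congr rfl fun t _ => Finset.sum_congr rfl fun k' _ => ?_
      ring
  simp only [hl, Finset.sum_add_distrib, Sum.elim_inl, Sum.elim_inr, cauchyVandermonde,
    Matrix.of_apply]
  congr 1
  rw [Finset.sum_comm]
  exact Finset.sum_congr rfl fun t _ => (Finset.mul_sum _ _ _).symm

theorem csaCode_isRecoverable (h : Distinct f α) (hℓ : 0 < ℓ) (hKc : 0 < Kc) :
    (csaCode f α lam kap mu).IsRecoverable ((ℓ + 1) * Kc - 1) := by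
  intro T hT A B
  ext q i j
  obtain ⟨e, he⟩ := exists_answers_eq h A B T i j
  set p := finProdFinEquiv.symm q with hp
  have hq : finProdFinEquiv p = q := finProdFinEquiv.apply_symm_apply q
  change (residueCoeff f p.1 p.2)⁻¹ * ∑ s : T, decodingMatrix f α T (Sum.inl p) s *
    (csaCode f α lam kap mu).answers T A B s (i, j) = _
  set w := Sum.elim (fun p : Fin ℓ × Fin Kc =>
        residueCoeff f p.1 p.2 * (A (finProdFinEquiv p) * B (finProdFinEquiv p)) i j) e with hw
  have h1 : ∑ s : T, decodingMatrix f α T (Sum.inl p) s *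
      (csaCode f α lam kap mu).answers T A B s (i, j) = w (Sum.inl p) := by
    have h2 : (decodingMatrix f α T * cauchyVandermonde f α T).mulVec w = w := by
      rw [decodingMatrix_mul h hℓ hKc hT, Matrix.one_mulVec]
    rw [← Matrix.mulVec_mulVec] at h2
    conv_rhs => rw [← h2]
    simp only [he]
    rfl
  rw [h1, hw, Sum.elim_inl, ← mul_assoc,
    inv_mul_cancel₀ (h.residueCoeff_ne_zero p.1 p.2), one_mul, hq]

/-- Inputs supported in one entry reduce the impossibility proof to scalars. -/
theorem answers_single (a b : Fin ℓ × Fin Kc → F) (i₀ : Fin lam) (k₀ : Fin kap) (j₀ : Fin mu)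
    (s : T) (i : Fin lam) (j : Fin mu) :
    (csaCode f α lam kap mu).answers T
      (fun q => Matrix.single i₀ k₀ (a (finProdFinEquiv.symm q)))
      (fun q => Matrix.single k₀ j₀ (b (finProdFinEquiv.symm q))) s (i, j) =
    if i₀ = i ∧ j₀ = j then ∑ l, Delta f α l s * (∑ k, a (l, k) / (f l k - α s)) *
      ∑ k, b (l, k) / (f l k - α s) else 0 := by
  rw [answers_apply]
  simp only [shareA_mul_shareB, Equiv.symm_apply_apply, Matrix.single_mul_single_same,
    Matrix.single_apply]
  split_ifs
  · refine Finset.sum_congr rfl fun l _ => ?_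
    rw [mul_assoc, Finset.sum_mul_sum, Finset.mul_sum]
    refine Finset.sum_congr rfl fun k _ => ?_
    rw [Finset.mul_sum]
    exact Finset.sum_congr rfl fun k' _ => by ring
  · simp

theorem Delta_mul_sum (h : Distinct f α) (l : Fin ℓ) {p : Polynomial F} (hp : p.degree < Kc)
    (s : Fin S) :
    Delta f α l s * ∑ k, p.eval (f l k) / residueCoeff f l k / (f l k - α s) = p.eval (α s) :=
  (eval_eq_prod_mul_sum (h.injective_block l) (by simpa using hp) fun k => h.ne l k s).symm

theorem exists_indistinguishable (h : Distinct f α) (hℓ : 0 < ℓ) (hKc : 0 < Kc) (hlam : 0 < lam)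
    (hkap : 0 < kap) (hmu : 0 < mu) (hS : (ℓ + 1) * Kc - 1 ≤ S)
    (hT : T.card < (ℓ + 1) * Kc - 1) :
    ∃ A A' B B', (csaCode f α lam kap mu).answers T A B =
      (csaCode f α lam kap mu).answers T A' B' ∧
      (fun l => A l * B l) ≠ fun l => A' l * B' l := by
  obtain ⟨T', hTT', hT'⟩ := Finset.exists_superset_card_eq (s := T) hT.le (by simpa using hS)
  obtain ⟨s₀, hs₀, hs₀T⟩ : ∃ s ∈ T', s ∉ T := Finset.exists_mem_notMem_of_card_lt_card (by omega)
  -- The Cauchy–Vandermonde matrix maps this column to the unit vector at `s₀`, hence to zero on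
  -- `T`: there the Cauchy part of `w` cancels its polynomial part.
  set w := fun c => decodingMatrix f α T' c ⟨s₀, hs₀⟩ with hw
  have hw0 : ∀ s ∈ T, ∑ p : Fin ℓ × Fin Kc, w (Sum.inl p) / (f p.1 p.2 - α s) =
      -∑ i : Fin (Kc - 1), w (Sum.inr i) * α s ^ (i : ℕ) := by
    intro s hs
    have h1 := congrFun (congrFun (cauchyVandermonde_mul h hℓ hKc hT') ⟨s, hTT' hs⟩) ⟨s₀, hs₀⟩
    rw [Matrix.one_apply_ne (by rintro ⟨⟩; exact hs₀T hs), Matrix.mul_apply,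
      Fintype.sum_sum_type] at h1
    rw [← eq_neg_iff_add_eq_zero] at h1
    simpa [cauchyVandermonde, div_eq_inv_mul, mul_comm] using h1
  set l₀ : Fin ℓ := ⟨0, hℓ⟩
  set k₀ : Fin Kc := ⟨0, hKc⟩
  set E : Polynomial F := ∑ i : Fin (Kc - 1),
    Polynomial.C (w (Sum.inr i)) * Polynomial.X ^ (i : ℕ) with hE
  set Q : Polynomial F := (Polynomial.X - Polynomial.C (f l₀ k₀)) * E with hQ
  have hEe : ∀ x, E.eval x = ∑ i : Fin (Kc - 1), w (Sum.inr i) * x ^ (i : ℕ) := fun x => by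
    simp [hE, Polynomial.eval_finsetSum]
  have hQd : Q.degree < Kc := by
    have hEd : E.degree < (Kc - 1 : ℕ) := Polynomial.degree_sum_fin_lt _
    by_cases hE0 : E = 0
    · rw [hQ, hE0, mul_zero, Polynomial.degree_zero]
      exact WithBot.bot_lt_coe _
    · rw [hQ, Polynomial.degree_mul, Polynomial.degree_X_sub_C,
        Polynomial.degree_eq_natDegree hE0]
      have := (Polynomial.natDegree_lt_iff_degree_lt hE0).2 hEd
      exact_mod_cast (show 1 + E.natDegree < Kc by omega)
  -- With `a`, every share of `A` is 1 and the answers are the Cauchy part of `w`, that is `-E(α s)`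
  -- on `T`. With `a'` and `b'` the group `l₀` has shares `Q(α s)` and `1 / (f l₀ k₀ - α s)`, whose
  -- product is again `-E(α s)`. The products at `(l₀, k₀)` differ: `a * w` is nonzero there, while
  -- `Q` vanishes at `f l₀ k₀`.
  set a : Fin ℓ × Fin Kc → F := fun p => 1 / residueCoeff f p.1 p.2 with ha
  set a' : Fin ℓ × Fin Kc → F := fun p =>
    if p.1 = l₀ then Q.eval (f p.1 p.2) / residueCoeff f p.1 p.2 else 0 with ha'
  set b' : Fin ℓ × Fin Kc → F := fun p => if p = (l₀, k₀) then 1 else 0 with hb'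
  set i₁ : Fin lam := ⟨0, hlam⟩
  set j₁ : Fin kap := ⟨0, hkap⟩
  set m₁ : Fin mu := ⟨0, hmu⟩
  refine ⟨fun q => Matrix.single i₁ j₁ (a (finProdFinEquiv.symm q)),
    fun q => Matrix.single i₁ j₁ (a' (finProdFinEquiv.symm q)),
    fun q => Matrix.single j₁ m₁ (w (Sum.inl (finProdFinEquiv.symm q))),
    fun q => Matrix.single j₁ m₁ (b' (finProdFinEquiv.symm q)), ?_, ?_⟩
  · ext s ⟨i, j⟩
    rw [answers_single a (fun p => w (Sum.inl p)), answers_single a' b']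
    split_ifs
    · have h1 : ∀ l, Delta f α l s * ∑ k, a (l, k) / (f l k - α s) = 1 := fun l => by
        have := Delta_mul_sum h l (p := 1) (by
          rw [Polynomial.degree_one]
          exact_mod_cast hKc) s
        simpa [ha] using this
      have h2 := Delta_mul_sum h l₀ hQd s
      simp only [h1, one_mul]
      rw [← Fintype.sum_prod_type (fun p : Fin ℓ × Fin Kc => w (Sum.inl p) / (f p.1 p.2 - α s)),
        hw0 s s.2, Finset.sum_eq_single l₀]
      · have h3 : ∑ k, b' (l₀, k) / (f l₀ k - α s) = 1 / (f l₀ k₀ - α s) := by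
          rw [Finset.sum_eq_single k₀]
          · simp [hb']
          · intro k _ hk
            simp [hb', hk]
          · simp
        have h4 : f l₀ k₀ - α s ≠ 0 := sub_ne_zero.2 (h.ne _ _ _)
        simp only [ha', if_true]
        rw [h2, h3, hQ, Polynomial.eval_mul, hEe]
        simp only [Polynomial.eval_sub, Polynomial.eval_X, Polynomial.eval_C]
        rw [← neg_sub (f l₀ k₀) (α s)]
        field_simp
      · intro l _ hl
        simp [ha', hl]
      · simp
    · rfl
  · intro heq
    have h1 := congrFun (congrFun (congrFun heq (finProdFinEquiv (l₀, k₀))) i₁) m₁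
    simp only [Equiv.symm_apply_apply, Matrix.single_mul_single_same, Matrix.single_apply_same]
      at h1
    have h2 : a' (l₀, k₀) = 0 := by simp [ha', hQ]
    rw [h2, zero_mul] at h1
    refine mul_ne_zero (one_div_ne_zero (h.residueCoeff_ne_zero _ _)) ?_ h1
    rw [hw]
    simp only
    rw [decodingMatrix_inl h hℓ hKc hT']
    exact decodingRow_ne_zero h _ _

theorem csaCode_not_decodable (h : Distinct f α) (hℓ : 0 < ℓ) (hKc : 0 < Kc) (hlam : 0 < lam)
    (hkap : 0 < kap) (hmu : 0 < mu) (hS : (ℓ + 1) * Kc - 1 ≤ S)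
    (hT : T.card < (ℓ + 1) * Kc - 1) :
    ¬ ∃ d : (∀ s : T, (csaCode f α lam kap mu).Ans s → F) →
        Fin (ℓ * Kc) → Matrix (Fin lam) (Fin mu) F,
      ∀ A B, d ((csaCode f α lam kap mu).answers T A B) = fun l => A l * B l := by
  rintro ⟨d, hd⟩
  obtain ⟨A, A', B, B', h1, h2⟩ := exists_indistinguishable h hℓ hKc hlam hkap hmu hS hT
  exact h2 (by rw [← hd, ← hd, h1])

theorem csaCode_recoveryThreshold (h : Distinct f α) (hℓ : 0 < ℓ) (hKc : 0 < Kc) (hlam : 0 < lam)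
    (hkap : 0 < kap) (hmu : 0 < mu) (hS : (ℓ + 1) * Kc - 1 ≤ S) :
    (csaCode f α lam kap mu).recoveryThreshold = (ℓ + 1) * Kc - 1 := by
  refine le_antisymm (Nat.sInf_le (csaCode_isRecoverable h hℓ hKc))
    (le_csInf ⟨_, csaCode_isRecoverable h hℓ hKc⟩ fun r hr => ?_)
  by_contra! hlt
  -- As `r < R ≤ S`, a set of `r` servers exists and recoverability is not vacuous.
  obtain ⟨T, _, hT⟩ := Finset.exists_subset_card_eq (s := (Finset.univ : Finset (Fin S)))
    (n := r) (by simpa using hlt.le.trans hS)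
  exact csaCode_not_decodable h hℓ hKc hlam hkap hmu hS (T := T) (by omega) ⟨_, hr T hT⟩

end Recovery

/-! ### Complexities of the code -/

section Complexity

theorem exists_reach_scaled_cauchy (F : Type u) [Field F] (X : Type*) {b : ℕ} (hb : 1 ≤ b) :
    ∃ N : ℕ, (N : ℝ) ≤ 3000002 * (b * softLogSq F b) ∧
      ∀ {I J : Type} [Fintype I] [Fintype J], Fintype.card I ≤ b → Fintype.card J ≤ b →
        ∀ (x : I → F) (y : J → F), (∀ i j, x i ≠ y j) → ∀ (c : I → F) (d : J → F)
          (u : I → X → F),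
          Reach (Set.range u) (Set.range fun j v => d j * ∑ i, c i * u i v / (x i - y j)) N := by
  obtain ⟨N, hN, h⟩ := exists_reach_cauchy F X hb
  refine ⟨b + N + b, ?_, fun {I J} _ _ hI hJ x y hxy c d u => ?_⟩
  · have := one_le_softLogSq F hb
    have hb0 : (0 : ℝ) ≤ b := Nat.cast_nonneg b
    push_cast
    nlinarith
  · have h1 : Reach (Set.range u) (Set.range fun i v => c i * u i v) b := by
      refine Reach.of_forall (n := 1) Finset.univ (Q := fun i => {fun v => c i * u i v})
        (fun i _ => Reach.const_mul (Set.mem_range_self i) (c i)) ?_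
        (by simpa using hI)
      rintro _ ⟨i, rfl⟩
      exact Set.mem_biUnion (Finset.mem_coe.2 (Finset.mem_univ i)) rfl
    have h2 := h hI hJ x y hxy fun i v => c i * u i v
    refine (h1.trans h2).trans (Reach.of_forall (n := 1) Finset.univ
      (Q := fun j => {fun v => d j * ∑ i, c i * u i v / (x i - y j)})
      (fun j _ => Reach.const_mul (u := fun v => ∑ i, c i * u i v / (x i - y j))
        (Set.mem_range_self j) (d j)) ?_ (by simpa using hJ))
    rintro _ ⟨j, rfl⟩
    exact Set.mem_biUnion (Finset.mem_coe.2 (Finset.mem_univ j)) rfl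

variable {F : Type u} [Field F] {S ℓ Kc lam kap mu : ℕ} {f : Fin ℓ → Fin Kc → F}
  {α : Fin S → F}

theorem csaCode_serverComplexityLE (hℓ : 0 < ℓ) (hKc : 0 < Kc) (hkap : 0 < kap) :
    (csaCode f α lam kap mu).ServerComplexityLE (3 * ((lam : ℝ) * kap * mu / Kc)) := by
  intro s
  refine ⟨lam * mu * (ℓ * (kap * 2 + 1)), ?_, Reach.computableWithOps ?_⟩
  · have h1 : (0 : ℝ) < ℓ := by exact_mod_cast hℓ
    have h2 : (0 : ℝ) < Kc := by exact_mod_cast hKc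
    have h3 : (1 : ℝ) ≤ kap := by exact_mod_cast hkap
    push_cast
    rw [mul_div_assoc', div_le_div_iff₀ (by positivity) h2]
    have h4 : (0 : ℝ) ≤ lam * mu * ℓ * Kc := by positivity
    nlinarith
  · refine Reach.of_forall (Finset.univ : Finset (Fin lam × Fin mu)) (n := ℓ * (kap * 2 + 1))
      (Q := fun p => {fun x => ∑ l, ∑ j, x.1 (l, p.1, j) * x.2 (l, j, p.2)}) (fun p _ => ?_) ?_
      (by simp)
    · have h1 := Reach.sum (P := Set.range (Sum.elim
          (fun (i : Fin ℓ × Fin lam × Fin kap)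
            (x : (Fin ℓ × Fin lam × Fin kap → F) × (Fin ℓ × Fin kap × Fin mu → F)) => x.1 i)
          (fun j x => x.2 j))) (n := fun _ => kap * 2) (Finset.univ : Finset (Fin ℓ))
        (q := fun l x => ∑ j, x.1 (l, p.1, j) * x.2 (l, j, p.2)) (fun l _ => by
          have h2 := Reach.sum (P := Set.range (Sum.elim
              (fun (i : Fin ℓ × Fin lam × Fin kap)
                (x : (Fin ℓ × Fin lam × Fin kap → F) × (Fin ℓ × Fin kap × Fin mu → F)) => x.1 i)
              (fun j x => x.2 j))) (n := fun _ => 1) (Finset.univ : Finset (Fin kap))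
            (q := fun j x => x.1 (l, p.1, j) * x.2 (l, j, p.2)) (fun j _ =>
              Reach.mul ⟨Sum.inl (l, p.1, j), rfl⟩ ⟨Sum.inr (l, j, p.2), rfl⟩)
          simpa using h2)
      refine h1.mono_ops ?_
      simp
    · rintro _ ⟨p, rfl⟩
      exact Set.mem_biUnion (Finset.mem_coe.2 (Finset.mem_univ p)) rfl

theorem csaCode_encodingComplexityALE (h : Distinct f α) (hℓ : 0 < ℓ) (hKc : 0 < Kc)
    (hS : Kc ≤ S) :
    (csaCode f α lam kap mu).EncodingComplexityALE
      (3000002 * ((lam : ℝ) * kap * S / Kc * softLogSq F S)) := by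
  obtain ⟨N, hN, hC⟩ := exists_reach_scaled_cauchy F
    (Fin (ℓ * Kc) → Matrix (Fin lam) (Fin kap) F) (b := S) (by omega)
  refine ⟨ℓ * (lam * kap) * N, ?_, Reach.computableWithOps ?_⟩
  · have h1 : (0 : ℝ) < ℓ := by exact_mod_cast hℓ
    have h2 : (0 : ℝ) < Kc := by exact_mod_cast hKc
    push_cast
    calc (ℓ : ℝ) * (lam * kap) * N / (ℓ * Kc) = lam * kap / Kc * N := by field_simp
      _ ≤ lam * kap / Kc * (3000002 * (S * softLogSq F S)) := by gcongr
      _ = _ := by ring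
  · refine Reach.of_forall (Finset.univ : Finset (Fin ℓ × Fin lam × Fin kap)) (n := N)
      (Q := fun p => Set.range fun s A => shareA f α s A p.1 p.2.1 p.2.2) (fun p _ => ?_) ?_
      (by simp)
    · have h1 := hC (I := Fin Kc) (J := Fin S) (by simpa using hS) (by simp) (f p.1) α
        (fun k s => h.ne _ _ _) (fun _ => 1) (fun s => Delta f α p.1 s)
        (fun k A => A (finProdFinEquiv (p.1, k)) p.2.1 p.2.2)
      refine (h1.mono_left ?_).mono_right ?_
      · rintro _ ⟨k, rfl⟩
        exact ⟨(finProdFinEquiv (p.1, k), p.2.1, p.2.2), rfl⟩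
      · rintro _ ⟨s, rfl⟩
        refine ⟨s, ?_⟩
        ext A
        simp [shareA, Matrix.sum_apply, div_eq_inv_mul]
    · rintro _ ⟨⟨s, p⟩, rfl⟩
      exact Set.mem_biUnion (Finset.mem_coe.2 (Finset.mem_univ p)) ⟨s, rfl⟩

theorem csaCode_encodingComplexityBLE (h : Distinct f α) (hℓ : 0 < ℓ) (hKc : 0 < Kc)
    (hS : Kc ≤ S) :
    (csaCode f α lam kap mu).EncodingComplexityBLE
      (3000002 * ((kap : ℝ) * mu * S / Kc * softLogSq F S)) := by
  obtain ⟨N, hN, hC⟩ := exists_reach_scaled_cauchy F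
    (Fin (ℓ * Kc) → Matrix (Fin kap) (Fin mu) F) (b := S) (by omega)
  refine ⟨ℓ * (kap * mu) * N, ?_, Reach.computableWithOps ?_⟩
  · have h1 : (0 : ℝ) < ℓ := by exact_mod_cast hℓ
    have h2 : (0 : ℝ) < Kc := by exact_mod_cast hKc
    push_cast
    calc (ℓ : ℝ) * (kap * mu) * N / (ℓ * Kc) = kap * mu / Kc * N := by field_simp
      _ ≤ kap * mu / Kc * (3000002 * (S * softLogSq F S)) := by gcongr
      _ = _ := by ring
  · refine Reach.of_forall (Finset.univ : Finset (Fin ℓ × Fin kap × Fin mu)) (n := N)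
      (Q := fun p => Set.range fun s B => shareB f α s B p.1 p.2.1 p.2.2) (fun p _ => ?_) ?_
      (by simp)
    · have h1 := hC (I := Fin Kc) (J := Fin S) (by simpa using hS) (by simp) (f p.1) α
        (fun k s => h.ne _ _ _) (fun _ => 1) (fun _ => 1)
        (fun k B => B (finProdFinEquiv (p.1, k)) p.2.1 p.2.2)
      refine (h1.mono_left ?_).mono_right ?_
      · rintro _ ⟨k, rfl⟩
        exact ⟨(finProdFinEquiv (p.1, k), p.2.1, p.2.2), rfl⟩
      · rintro _ ⟨s, rfl⟩
        refine ⟨s, ?_⟩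
        ext B
        simp [shareB, Matrix.sum_apply, div_eq_inv_mul]
    · rintro _ ⟨⟨s, p⟩, rfl⟩
      exact Set.mem_biUnion (Finset.mem_coe.2 (Finset.mem_univ p)) ⟨s, rfl⟩

theorem csaCode_decodingComplexityLE (h : Distinct f α) (hℓ : 0 < ℓ) (hKc : 0 < Kc)
    (hlam : 0 < lam) (hkap : 0 < kap) (hmu : 0 < mu) (hS : (ℓ + 1) * Kc - 1 ≤ S) :
    (csaCode f α lam kap mu).DecodingComplexityLE
      (6000004 * ((lam : ℝ) * mu * softLogSq F ((ℓ + 1) * Kc - 1))) := by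
  intro T hT
  rw [csaCode_recoveryThreshold h hℓ hKc hlam hkap hmu hS] at hT
  have hL : 0 < ℓ * Kc := Nat.mul_pos hℓ hKc
  have hKL : Kc ≤ ℓ * Kc := Nat.le_mul_of_pos_left _ hℓ
  have hR : (ℓ + 1) * Kc - 1 = ℓ * Kc + Kc - 1 := by rw [add_mul, one_mul]
  set R := (ℓ + 1) * Kc - 1
  obtain ⟨N, hN, hC⟩ := exists_reach_scaled_cauchy F
    (∀ s : T, (csaCode f α lam kap mu).Ans s → F) (b := R) (by omega)
  refine ⟨lam * mu * N, ?_, Reach.computableWithOps ?_⟩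
  · have hL' : (0 : ℝ) < ℓ * Kc := by exact_mod_cast hL
    -- Since `Kc ≤ L`, the size `R = L + Kc - 1` is less than `2 * L`; normalizing by `L` leaves
    -- only the factor 2.
    have h2 : (R : ℝ) ≤ 2 * (ℓ * Kc) := by exact_mod_cast (by omega : R ≤ 2 * (ℓ * Kc))
    have h3 : 0 ≤ softLogSq F R := zero_le_one.trans (one_le_softLogSq F (by omega))
    push_cast
    rw [div_le_iff₀ hL']
    calc (lam : ℝ) * mu * N ≤ lam * mu * (3000002 * (2 * (ℓ * Kc) * softLogSq F R)) := by
          gcongr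
          exact hN.trans (by gcongr)
      _ = _ := by ring
  · refine Reach.of_forall (Finset.univ : Finset (Fin lam × Fin mu)) (n := N)
      (Q := fun p => Set.range fun q y => (csaCode f α lam kap mu).dec T y q p.1 p.2)
      (fun p _ => ?_) ?_ (by simp)
    · have h1 := hC (I := T) (J := Fin ℓ × Fin Kc) (by simp [hT]) (by simp; omega)
        (fun s => α s) (fun q => f q.1 q.2) (fun s q => (h.ne _ _ _).symm)
        (fun s => (∏ p' : Fin ℓ × Fin Kc, (f p'.1 p'.2 - α s)) /
          ∏ s' ∈ Finset.univ.erase s, (α s' - α s))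
        (fun q => (residueCoeff f q.1 q.2)⁻¹ * ((∏ s' : T, (α s' - f q.1 q.2)) /
          ∏ p' ∈ Finset.univ.erase q, (f p'.1 p'.2 - f q.1 q.2)))
        (fun s y => y s (p.1, p.2))
      refine (h1.mono_left ?_).mono_right ?_
      · rintro _ ⟨s, rfl⟩
        exact ⟨⟨s, (p.1, p.2)⟩, rfl⟩
      · rintro _ ⟨q, rfl⟩
        refine ⟨finProdFinEquiv.symm q, ?_⟩
        ext y
        generalize hq : finProdFinEquiv.symm q = r
        change _ = (residueCoeff f (finProdFinEquiv.symm q).1 (finProdFinEquiv.symm q).2)⁻¹ *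
          ∑ s : T, decodingMatrix f α T (Sum.inl (finProdFinEquiv.symm q)) s * y s (p.1, p.2)
        rw [hq]
        simp only [decodingMatrix_inl h hℓ hKc hT, decodingRow]
        rw [mul_assoc, Finset.mul_sum]
        congr 1
        refine Finset.sum_congr rfl fun s _ => ?_
        ring
    · rintro _ ⟨⟨q, i, j⟩, rfl⟩
      exact Set.mem_biUnion (Finset.mem_coe.2 (Finset.mem_univ (i, j))) ⟨q, rfl⟩

end Complexity

/-! ### Communication costs and existence of evaluation points -/

section Costs

variable {F : Type*} [Field F] {S ℓ Kc lam kap mu : ℕ} {f : Fin ℓ → Fin Kc → F}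
  {α : Fin S → F}

theorem csaCode_uploadCostA (hℓ : 0 < ℓ) (hlam : 0 < lam) (hkap : 0 < kap) :
    (csaCode f α lam kap mu).uploadCostA = (S : ℝ) / Kc := by
  have hc : ∀ s, Fintype.card ((csaCode f α lam kap mu).ShA s) = ℓ * (lam * kap) := fun s => by
    change Fintype.card (Fin ℓ × Fin lam × Fin kap) = _
    simp
  simp only [CDBMMCode.uploadCostA, hc, Finset.sum_const, Finset.card_univ, Fintype.card_fin]
  push_cast
  rw [nsmul_eq_mul]
  field_simp

theorem csaCode_uploadCostB (hℓ : 0 < ℓ) (hkap : 0 < kap) (hmu : 0 < mu) :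
    (csaCode f α lam kap mu).uploadCostB = (S : ℝ) / Kc := by
  have hc : ∀ s, Fintype.card ((csaCode f α lam kap mu).ShB s) = ℓ * (kap * mu) := fun s => by
    change Fintype.card (Fin ℓ × Fin kap × Fin mu) = _
    simp
  simp only [CDBMMCode.uploadCostB, hc, Finset.sum_const, Finset.card_univ, Fintype.card_fin]
  push_cast
  rw [nsmul_eq_mul]
  field_simp

theorem csaCode_downloadCost (h : Distinct f α) (hℓ : 0 < ℓ) (hKc : 0 < Kc) (hlam : 0 < lam)
    (hkap : 0 < kap) (hmu : 0 < mu) (hS : (ℓ + 1) * Kc - 1 ≤ S) :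
    (csaCode f α lam kap mu).downloadCost = (((ℓ : ℝ) + 1) * Kc - 1) / ((ℓ : ℝ) * Kc) := by
  have hc : ∀ s, Fintype.card ((csaCode f α lam kap mu).Ans s) = lam * mu := fun s => by
    change Fintype.card (Fin lam × Fin mu) = _
    simp
  have hsup : ((Finset.univ.powersetCard ((ℓ + 1) * Kc - 1)).sup
      fun T : Finset (Fin S) => ∑ s ∈ T, Fintype.card ((csaCode f α lam kap mu).Ans s)) =
      ((ℓ + 1) * Kc - 1) * (lam * mu) := by
    have hne : (Finset.univ.powersetCard ((ℓ + 1) * Kc - 1) : Finset (Finset (Fin S))).Nonempty :=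
      Finset.powersetCard_nonempty.2 (by rwa [Finset.card_univ, Fintype.card_fin])
    rw [← Finset.sup_const hne (((ℓ + 1) * Kc - 1) * (lam * mu))]
    refine Finset.sup_congr rfl fun T hT => ?_
    simp [hc, (Finset.mem_powersetCard.1 hT).2]
  rw [CDBMMCode.downloadCost, csaCode_recoveryThreshold h hℓ hKc hlam hkap hmu hS, hsup]
  have h1 : 1 ≤ (ℓ + 1) * Kc := Nat.mul_pos (Nat.succ_pos ℓ) hKc
  push_cast [Nat.cast_sub h1]
  field_simp

end Costs

theorem exists_distinct {F : Type*} [Finite F] {S ℓ Kc : ℕ} (hF : ℓ * Kc + S ≤ Nat.card F) :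
    ∃ (f : Fin ℓ → Fin Kc → F) (α : Fin S → F), Distinct f α := by
  have := Fintype.ofFinite F
  obtain ⟨e⟩ := Function.Embedding.nonempty_of_card_le
    (α := (Fin ℓ × Fin Kc) ⊕ Fin S) (β := F) (by simpa using hF)
  refine ⟨fun l k => e (Sum.inl (l, k)), fun s => e (Sum.inr s), ?_⟩
  have he : Sum.elim (fun p : Fin ℓ × Fin Kc => e (Sum.inl (p.1, p.2)))
      (fun s => e (Sum.inr s)) = e := by ext (p | s) <;> rfl
  rw [Distinct, he]
  exact e.injective

end CSA

theorem theorem1 :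
    ∃ C : ℝ, 0 < C ∧
      ∀ (F : Type u) [Field F] [Finite F] (S ℓ Kc lam kap mu : ℕ),
        0 < ℓ → 0 < Kc → 0 < lam → 0 < kap → 0 < mu →
        (ℓ + 1) * Kc - 1 ≤ S →
        ℓ * Kc + S ≤ Nat.card F →
        (∃ (f : Fin ℓ → Fin Kc → F) (α : Fin S → F),
          Function.Injective (Sum.elim (fun p : Fin ℓ × Fin Kc => f p.1 p.2) α)) ∧
        ∀ (f : Fin ℓ → Fin Kc → F) (α : Fin S → F),
          Function.Injective (Sum.elim (fun p : Fin ℓ × Fin Kc => f p.1 p.2) α) →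
          -- the answers of any `(ℓ + 1) Kc - 1` servers are decoded correctly, and this is the
          -- recovery threshold
          (CSA.csaCode f α lam kap mu).IsRecoverable ((ℓ + 1) * Kc - 1) ∧
          (CSA.csaCode f α lam kap mu).recoveryThreshold = (ℓ + 1) * Kc - 1 ∧
          -- no decoding function whatsoever works for fewer servers
          (∀ T : Finset (Fin S), T.card < (ℓ + 1) * Kc - 1 →
            ¬ ∃ d : (∀ s : T, (CSA.csaCode f α lam kap mu).Ans s → F) →
                Fin (ℓ * Kc) → Matrix (Fin lam) (Fin mu) F,
              ∀ A B, d ((CSA.csaCode f α lam kap mu).answers T A B) = fun l => A l * B l) ∧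
          -- communication costs
          (CSA.csaCode f α lam kap mu).uploadCostA = (S : ℝ) / Kc ∧
          (CSA.csaCode f α lam kap mu).uploadCostB = (S : ℝ) / Kc ∧
          (CSA.csaCode f α lam kap mu).downloadCost =
            (((ℓ : ℝ) + 1) * Kc - 1) / ((ℓ : ℝ) * Kc) ∧
          -- computational complexities
          (CSA.csaCode f α lam kap mu).ServerComplexityLE
            (C * ((lam : ℝ) * kap * mu / Kc)) ∧
          (CSA.csaCode f α lam kap mu).EncodingComplexityALE
            (C * ((lam : ℝ) * kap * S / Kc * CSA.softLogSq F S)) ∧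
          (CSA.csaCode f α lam kap mu).EncodingComplexityBLE
            (C * ((kap : ℝ) * mu * S / Kc * CSA.softLogSq F S)) ∧
          (CSA.csaCode f α lam kap mu).DecodingComplexityLE
            (C * ((lam : ℝ) * mu * CSA.softLogSq F ((ℓ + 1) * Kc - 1))) := by
  -- Any constant above `3`, `3000002` and `6000004`, those of the server, encoding and decoding
  -- bounds, will do.
  refine ⟨7000000, by norm_num, ?_⟩
  intro F _ _ S ℓ Kc lam kap mu hℓ hKc hlam hkap hmu hS hF
  refine ⟨CSA.exists_distinct hF, fun f α (h : CSA.Distinct f α) => ?_⟩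
  have hR : (ℓ + 1) * Kc - 1 = ℓ * Kc + Kc - 1 := by rw [add_mul, one_mul]
  have hL : 0 < ℓ * Kc := Nat.mul_pos hℓ hKc
  have hKS : Kc ≤ S := by omega
  have hS0 : 0 ≤ CSA.softLogSq F S := zero_le_one.trans (CSA.one_le_softLogSq F (by omega))
  have hR0 : 0 ≤ CSA.softLogSq F ((ℓ + 1) * Kc - 1) :=
    zero_le_one.trans (CSA.one_le_softLogSq F (by omega))
  refine ⟨CSA.csaCode_isRecoverable h hℓ hKc,
    CSA.csaCode_recoveryThreshold h hℓ hKc hlam hkap hmu hS,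
    fun T hT => CSA.csaCode_not_decodable h hℓ hKc hlam hkap hmu hS hT,
    CSA.csaCode_uploadCostA hℓ hlam hkap, CSA.csaCode_uploadCostB hℓ hkap hmu,
    CSA.csaCode_downloadCost h hℓ hKc hlam hkap hmu hS, fun s => ?_, ?_, ?_, fun T hT => ?_⟩
  · obtain ⟨n, hn, hc⟩ := CSA.csaCode_serverComplexityLE (f := f) (α := α) (lam := lam) (mu := mu)
      hℓ hKc hkap s
    exact ⟨n, hn.trans (by gcongr; norm_num), hc⟩
  · obtain ⟨n, hn, hc⟩ := CSA.csaCode_encodingComplexityALE (lam := lam) (kap := kap) (mu := mu)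
      h hℓ hKc hKS
    exact ⟨n, hn.trans (by gcongr; norm_num), hc⟩
  · obtain ⟨n, hn, hc⟩ := CSA.csaCode_encodingComplexityBLE (lam := lam) (kap := kap) (mu := mu)
      h hℓ hKc hKS
    exact ⟨n, hn.trans (by gcongr; norm_num), hc⟩
  · obtain ⟨n, hn, hc⟩ := CSA.csaCode_decodingComplexityLE h hℓ hKc hlam hkap hmu hS T hT
    exact ⟨n, hn.trans (by gcongr; norm_num), hc⟩
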